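/- Let $M$ be a smooth (Hausdorff, second countable, finite-dimensional) manifold, $A=C^\infty(M)$, and $(\Omega(M),\mathrm d)$ its exterior algebra of differential forms. Let $\delta:\Omega(M)\to\Omega(M)$ be an $\mathbb R$-linear map that lowers degree by one, satisfies $\delta^2=0$, the six-term relation $$\delta(a\omega\eta)-(\delta(a\omega))\eta-a\,\delta(\omega\eta)-(-1)^{|\omega|}\omega\,\delta(a\eta)+a(\delta\omega)\eta+(-1)^{|\omega|}a\,\omega\,\delta\eta=0$$ for all $a\in A$, $\omega,\eta\in\Omega(M)$, and the symmetry condition $\delta(a\,\mathrm db)-a\,\delta\mathrm db=\delta(b\,\mathrm da)-b\,\delta\mathrm da$ for all $a,b\in A$. For $\omega\in\Omega^1(M)$ let $\omega^*$ be the vector field $\omega^*(a)=\delta(a\omega)-a\,\delta\omega$, let $(\omega,\eta)=\eta(\omega^*)$ be the induced metric on $1$-forms (so $(\omega,\mathrm da)=\delta(a\omega)-a\,\delta\omega$), let $\mathfrak i_\omega$ be the interior product along $\omega^*$, and let $$\nabla_\omega\eta=\tfrac12\bigl(\delta(\omega\eta)-(\delta\omega)\eta+\omega\,\delta\eta+\mathfrak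 i_\omega\mathrm d\eta+\mathfrak i_\eta\mathrm d\omega+\mathrm d(\omega,\eta)\bigr),\qquad \omega,\eta\in\Omega^1(M).$$ Assume that $(\ ,\ )$ is nondegenerate, with inverse $g=\sum_i\alpha_i\otimes\beta_i\in\Omega^1(M)\otimes_A\Omega^1(M)$, i.e. $\sum_i(\omega,\alpha_i)\beta_i=\omega=\sum_i(\beta_i,\omega)\alpha_i$ for all $\omega\in\Omega^1(M)$. Let $\Delta=\mathrm d\delta+\delta\mathrm d$. (1) $\Delta$ extends canonically to $1$-$1$-forms: there is exactly one $\mathbb R$-linear map $\Delta:\Omega^1(M)\otimes_A\Omega^1(M)\to\Omega^1(M)\otimes_A\Omega^1(M)$ such that $$\Delta(\omega\otimes\eta)=\Delta\omega\otimes\eta+\omega\otimes\Delta\eta+2\sum_i\nabla_{\alpha_i}\omega\otimes\nabla_{\beta_i}\eta$$ for all $\omega,\eta\in\Omega^1(M)$ and every expression $g=\sum_i\alpha_i\otimes\beta_i$. (2) Suppose moreover that $\Delta$ is the Hodge Laplacian of the metric, i.e. that $\delta$ is the divergence (codifferential) of the metric that it induces: $\delta\omega=\sum_i(\alpha_i,\nabla_{\beta_i}\omega)$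 for $\omega\in\Omega^1(M)$. Let $\mathrm{Ricci}(Y,Z)=\operatorname{tr}(X\mapsto R(X,Y)Z)$ be the Ricci tensor of $\nabla$, where $R(X,Y)=[\nabla_X,\nabla_Y]-\nabla_{[X,Y]}$, let $S=(\ ,\ )\mathrm{Ricci}$ be its trace with respect to the metric, and let $\mathrm{Einstein}=\mathrm{Ricci}-\tfrac12 S\,g$. Then $$-\tfrac12\Delta g=\mathrm{Ricci},\qquad S=-\tfrac12(\ ,\ )\Delta g,\qquad \mathrm{Einstein}=-\tfrac12(\Delta+S)\,g.$$ -/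

import Mathlib

open scoped Manifold TensorProduct DirectSum

noncomputable section

namespace DerivationForms

/-! ### Differential forms over a commutative real algebra

For `A = C^∞(M)` the derivations of `A` are the smooth vector fields on `M`, and the alternating
`A`-multilinear maps from `k` vector fields to `A` are the differential `k`-forms on `M`. -/

/-- Vector fields: derivations of the algebra of functions. -/
abbrev VecField (A : Type*) [CommRing A] [Algebra ℝ A] : Type _ := Derivation ℝ A A

/-- Differential `k`-forms. -/
abbrev Form (A : Type*) [CommRing A] [Algebra ℝ A] (k : ℕ) : Type _ :=
  VecField A [⋀^Fin k]→ₗ[A] A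

/-- The exterior algebra `Ω = ⨁ₖ Ωᵏ` of differential forms. -/
abbrev Forms (A : Type*) [CommRing A] [Algebra ℝ A] : Type _ := ⨁ k : ℕ, Form A k

/-- A `k`-form as an element of the exterior algebra. -/
abbrev incl {A : Type*} [CommRing A] [Algebra ℝ A] (k : ℕ) (ω : Form A k) : Forms A :=
  DirectSum.lof A ℕ (fun k : ℕ => Form A k) k ω

/-- The exterior product of a `p`-form and a `q`-form: the signed sum over shuffles, so that
`(ω ∧ η)(X, Y) = ω(X) η(Y) - ω(Y) η(X)` for `1`-forms. -/
def wedgePQ {A : Type*} [CommRing A] [Algebra ℝ A] (p q : ℕ) :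
    Form A p →ₗ[A] Form A q →ₗ[A] Form A (p + q) :=
  LinearMap.mk₂ A
    (fun ω η => ((LinearMap.mul' A A).compAlternatingMap
      (AlternatingMap.domCoprod ω η)).domDomCongr finSumFinEquiv)
    (fun ω ω' η => by
      ext v
      simp [← AlternatingMap.domCoprod'_apply, TensorProduct.add_tmul,
        -AlternatingMap.domCoprod_apply])
    (fun c ω η => by
      ext v
      simp [← AlternatingMap.domCoprod'_apply, ← TensorProduct.smul_tmul',
        -AlternatingMap.domCoprod_apply])
    (fun ω η η' => by
      ext v
      simp [← AlternatingMap.domCoprod'_apply, TensorProduct.tmul_add,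
        -AlternatingMap.domCoprod_apply])
    (fun c ω η => by
      ext v
      simp [← AlternatingMap.domCoprod'_apply, -AlternatingMap.domCoprod_apply])

/-- The exterior product on `Ω`. -/
def wedge {A : Type*} [CommRing A] [Algebra ℝ A] : Forms A →ₗ[A] Forms A →ₗ[A] Forms A :=
  DirectSum.toModule A ℕ _ fun p => LinearMap.flip <| DirectSum.toModule A ℕ _ fun q =>
    LinearMap.flip <| (wedgePQ p q).compr₂ (DirectSum.lof A ℕ (fun k : ℕ => Form A k) (p + q))

theorem wedge_incl {A : Type*} [CommRing A] [Algebra ℝ A] {p q : ℕ} (ω : Form A p)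
    (η : Form A q) : wedge (incl p ω) (incl q η) = incl (p + q) (wedgePQ (A := A) p q ω η) := by
  simp [wedge]

/-- A function regarded as a `0`-form. -/
def funForm {A : Type*} [CommRing A] [Algebra ℝ A] (a : A) : Form A 0 :=
  AlternatingMap.constOfIsEmpty A (VecField A) (Fin 0) a

theorem wedgePQ_funForm {A : Type*} [CommRing A] [Algebra ℝ A] {p : ℕ} (ω : Form A p) (b : A) :
    wedgePQ (A := A) p 0 ω (funForm b) = b • ω := by
  ext v
  have key : ∀ σ : Equiv.Perm.ModSumCongr (Fin p) (Fin 0),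
      σ = Quotient.mk'' (1 : Equiv.Perm (Fin p ⊕ Fin 0)) := by
    intro σ
    induction σ using Quotient.inductionOn' with
    | h τ =>
      refine (Quotient.eq'' (s₁ := QuotientGroup.leftRel _)).2 ?_
      rw [QuotientGroup.leftRel_apply]
      refine Equiv.Perm.mem_sumCongrHom_range_of_perm_mapsTo_inl ?_
      rintro _ ⟨x, rfl⟩
      rcases h : (τ⁻¹ * 1) (Sum.inl x) with y | y
      · exact ⟨y, rfl⟩
      · exact y.elim0
  have hu : (Finset.univ : Finset (Equiv.Perm.ModSumCongr (Fin p) (Fin 0))) =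
      {Quotient.mk'' (1 : Equiv.Perm (Fin p ⊕ Fin 0))} := by
    ext σ
    simp [key σ]
  simp only [wedgePQ, LinearMap.mk₂_apply, AlternatingMap.domDomCongr_apply,
    LinearMap.compAlternatingMap_apply, AlternatingMap.domCoprod_apply, hu,
    Finset.sum_singleton, AlternatingMap.domCoprod.summand_mk'']
  simp [funForm, MultilinearMap.domCoprod_apply, mul_comm]
  rfl

theorem wedge_funForm {A : Type*} [CommRing A] [Algebra ℝ A] (x : Forms A) (b : A) :
    wedge x (incl 0 (funForm b)) = b • x := by
  induction x using DirectSum.induction_on (β := fun k : ℕ => Form A k) with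
  | zero => simp
  | of p ω =>
    have h := wedge_incl (A := A) ω (funForm b)
    rw [wedgePQ_funForm] at h
    exact h.trans (map_smul (DirectSum.lof A ℕ (fun k : ℕ => Form A k) p) b ω)
  | add x y hx hy => rw [map_add, LinearMap.add_apply, hx, hy, smul_add]

/-- The exterior derivative of a function: `(da)(X) = X(a)`. -/
def d₀ {A : Type*} [CommRing A] [Algebra ℝ A] (a : A) : Form A 1 where
  toFun v := v 0 a
  map_update_add' v i X Y := by fin_cases i; simp
  map_update_smul' v i c X := by fin_cases i; simp
  map_eq_zero_of_eq' v i j _ hij := absurd (Subsingleton.elim i j) hij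

theorem form_add {A : Type*} [CommRing A] [Algebra ℝ A] (ω : Form A 1) (X Y : VecField A) :
    ω ![X + Y] = ω ![X] + ω ![Y] := by
  have h := ω.map_update_add ![X] 0 X Y
  have e (Z : VecField A) : Function.update ![X] 0 Z = ![Z] := by
    ext i; fin_cases i; simp
  rwa [e, e, e] at h

theorem form_smul {A : Type*} [CommRing A] [Algebra ℝ A] (ω : Form A 1) (a : A) (X : VecField A) :
    ω ![a • X] = a * ω ![X] := by
  have h := ω.map_update_smul ![X] 0 a X
  have e (Z : VecField A) : Function.update ![X] 0 Z = ![Z] := by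
    ext i; fin_cases i; simp
  rwa [e, e] at h

theorem smul_lie_vec {A : Type*} [CommRing A] [Algebra ℝ A] (a : A) (X Y : VecField A) :
    ⁅a • X, Y⁆ = a • ⁅X, Y⁆ + (-Y a) • X := by
  ext b
  simp only [Derivation.commutator_apply, Derivation.smul_apply, Derivation.add_apply, smul_eq_mul,
    Derivation.leibniz]
  ring

/-- The exterior derivative of a `1`-form: `(dω)(X, Y) = X(ω(Y)) - Y(ω(X)) - ω([X, Y])`. -/
def d₁ {A : Type*} [CommRing A] [Algebra ℝ A] (ω : Form A 1) : Form A 2 where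
  toFun v := v 0 (ω ![v 1]) - v 1 (ω ![v 0]) - ω ![⁅v 0, v 1⁆]
  map_update_add' v i X Y := by
    fin_cases i <;> simp [form_add] <;> ring
  map_update_smul' v i c X := by
    fin_cases i
    · simp [-neg_smul, form_add, form_smul, smul_lie_vec]
      ring
    · simp [form_add, form_smul]
      ring
  map_eq_zero_of_eq' v i j hv hij := by
    have h : v 0 = v 1 := by
      fin_cases i <;> fin_cases j <;> simp_all
    simpa [h] using form_smul ω 0 (v 1)

/-! ### The data determined by a codifferential -/

/-- The hypotheses on an operator `δ : Ω → Ω`: it lowers degree by one, squares to zero, obeys the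
six-term relation, and is symmetric. -/
structure IsSymmetricCodifferential {A : Type*} [CommRing A] [Algebra ℝ A]
    (δ : Forms A →ₗ[ℝ] Forms A) : Prop where
  map_zero_form : ∀ f : Form A 0, δ (incl 0 f) = 0
  map_succ_form : ∀ (k : ℕ) (ω : Form A (k + 1)), ∃ η : Form A k, δ (incl (k + 1) ω) = incl k η
  sq_zero : ∀ x : Forms A, δ (δ x) = 0
  six_term : ∀ (a : A) (p : ℕ) (ω : Form A p) (η : Forms A),
    δ (a • wedge (incl p ω) η) - wedge (δ (a • incl p ω)) η - a • δ (wedge (incl p ω) η)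
      - (-1 : ℝ) ^ p • wedge (incl p ω) (δ (a • η)) + a • wedge (δ (incl p ω)) η
      + (-1 : ℝ) ^ p • (a • wedge (incl p ω) (δ η)) = 0
  symm : ∀ a b : A, δ (a • incl 1 (d₀ b)) - a • δ (incl 1 (d₀ b)) =
    δ (b • incl 1 (d₀ a)) - b • δ (incl 1 (d₀ a))

/-- `δ` on `1`-forms, as a function. -/
def codiff₁ {A : Type*} [CommRing A] [Algebra ℝ A] (δ : Forms A →ₗ[ℝ] Forms A) (ω : Form A 1) : A :=
  (δ (incl 1 ω)) 0 ![]

/-- `δ` on `2`-forms, as a `1`-form. -/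
def codiff₂ {A : Type*} [CommRing A] [Algebra ℝ A] (δ : Forms A →ₗ[ℝ] Forms A) (θ : Form A 2) :
    Form A 1 :=
  (δ (incl 2 θ)) 1

theorem codiff₁_add {A : Type*} [CommRing A] [Algebra ℝ A] (δ : Forms A →ₗ[ℝ] Forms A)
    (ω η : Form A 1) : codiff₁ δ (ω + η) = codiff₁ δ ω + codiff₁ δ η := by
  simp [codiff₁]

theorem codiff₁_mul_smul {A : Type*} [CommRing A] [Algebra ℝ A] {δ : Forms A →ₗ[ℝ] Forms A}
    (hδ : IsSymmetricCodifferential δ) (a b : A) (ω : Form A 1) :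
    codiff₁ δ ((a * b) • ω) =
      a * codiff₁ δ (b • ω) + b * codiff₁ δ (a • ω) - a * b * codiff₁ δ ω := by
  have h := hδ.six_term a 1 ω (incl 0 (funForm b))
  have e : a • incl 0 (funForm b) = incl 0 (a • funForm b) := (map_smul _ _ _).symm
  rw [e, hδ.map_zero_form, hδ.map_zero_form, wedge_funForm, wedge_funForm, wedge_funForm,
    map_zero, smul_zero, smul_zero, smul_zero, sub_zero, add_zero, smul_smul] at h
  have h' := congrArg (fun x : Forms A => x 0 ![]) h
  simp only [DirectSum.add_apply, DirectSum.sub_apply, DirectSum.smul_apply,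
    DirectSum.zero_apply, AlternatingMap.add_apply, AlternatingMap.sub_apply,
    AlternatingMap.smul_apply, AlternatingMap.zero_apply, smul_eq_mul] at h'
  simp only [codiff₁, map_smul]
  linear_combination h'

/-- The vector field `ω^* = (ω, ·)`, with `ω^*(a) = δ(a ω) - a δω`. -/
def sharp {A : Type*} [CommRing A] [Algebra ℝ A] {δ : Forms A →ₗ[ℝ] Forms A}
    (hδ : IsSymmetricCodifferential δ) : Form A 1 →ₗ[A] VecField A where
  toFun ω := Derivation.mk'
    { toFun := fun a => codiff₁ δ (a • ω) - a * codiff₁ δ ω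
      map_add' := fun a b => by
        rw [add_smul, codiff₁_add]; ring
      map_smul' := fun c a => by
        have h : incl 1 ((c • a) • ω) = c • incl 1 (a • ω) := by
          have e : (c • a) • ω = c • (a • ω) := by
            ext v
            simp
          rw [e]
          exact (DirectSum.lof ℝ ℕ (fun k : ℕ => Form A k) 1).map_smul c (a • ω)
        simp only [codiff₁, h, map_smul δ c, DirectSum.smul_apply, AlternatingMap.smul_apply,
          smul_mul_assoc, smul_sub, RingHom.id_apply] }
    (fun a b => by
      have h := codiff₁_mul_smul hδ a b ω
      simp only [LinearMap.coe_mk, AddHom.coe_mk, smul_eq_mul]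
      rw [h]; ring)
  map_add' ω η := by
    ext a
    simp [codiff₁_add]; ring
  map_smul' b ω := by
    ext a
    have h := codiff₁_mul_smul hδ a b ω
    simp [smul_smul, h]; ring

/-- The (possibly degenerate) metric `(ω, η)` on `1`-forms; in particular
`(ω, da) = δ(a ω) - a δω`. -/
def pairing {A : Type*} [CommRing A] [Algebra ℝ A] {δ : Forms A →ₗ[ℝ] Forms A}
    (hδ : IsSymmetricCodifferential δ) : Form A 1 →ₗ[A] Form A 1 →ₗ[A] A :=
  LinearMap.mk₂ A (fun ω η => η ![sharp hδ ω])
    (fun ω ω' η => by simp [form_add])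
    (fun c ω η => by simp [form_smul])
    (fun ω η η' => by simp)
    (fun c ω η => by simp)

theorem pairing_d₀ {A : Type*} [CommRing A] [Algebra ℝ A] {δ : Forms A →ₗ[ℝ] Forms A}
    (hδ : IsSymmetricCodifferential δ) (ω : Form A 1) (a : A) :
    pairing hδ ω (d₀ a) = codiff₁ δ (a • ω) - a * codiff₁ δ ω := rfl

/-- The interior product `𝔦_ω θ` of a `2`-form with a `1`-form. -/
def interior {A : Type*} [CommRing A] [Algebra ℝ A] {δ : Forms A →ₗ[ℝ] Forms A}
    (hδ : IsSymmetricCodifferential δ) (ω : Form A 1) (θ : Form A 2) : Form A 1 :=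
  θ.curryLeft (sharp hδ ω)

/-- The covariant derivative along `1`-forms,
`∇_ω η = ½ (δ(ωη) - (δω)η + ωδη + 𝔦_ω dη + 𝔦_η dω + d(ω, η))`. -/
def nabla {A : Type*} [CommRing A] [Algebra ℝ A] {δ : Forms A →ₗ[ℝ] Forms A}
    (hδ : IsSymmetricCodifferential δ) (ω η : Form A 1) : Form A 1 :=
  (1 / 2 : ℝ) • (codiff₂ δ (wedgePQ (A := A) 1 1 ω η) - codiff₁ δ ω • η + codiff₁ δ η • ω
    + interior hδ ω (d₁ η) + interior hδ η (d₁ ω) + d₀ (pairing hδ ω η))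

/-- The Hodge Laplacian `Δ = dδ + δd` on `1`-forms. -/
def hodgeLaplacian {A : Type*} [CommRing A] [Algebra ℝ A] (δ : Forms A →ₗ[ℝ] Forms A)
    (ω : Form A 1) : Form A 1 :=
  d₀ (codiff₁ δ ω) + codiff₂ δ (d₁ ω)

/-! ### `1`-`1`-forms and the metric -/

/-- `1`-`1`-forms: elements of `Ω¹ ⊗_A Ω¹`. -/
abbrev OneOneForm (A : Type*) [CommRing A] [Algebra ℝ A] : Type _ := Form A 1 ⊗[A] Form A 1

/-- Evaluation of a `1`-form on a vector field. -/
def evalVec {A : Type*} [CommRing A] [Algebra ℝ A] (X : VecField A) : Form A 1 →ₗ[A] A where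
  toFun ω := ω ![X]
  map_add' _ _ := rfl
  map_smul' _ _ := rfl

/-- Evaluation of a `1`-`1`-form on two vector fields: `(ω ⊗ η)(X, Y) = ω(X) η(Y)`. -/
def evalTensor {A : Type*} [CommRing A] [Algebra ℝ A] (X Y : VecField A) : OneOneForm A →ₗ[A] A :=
  LinearMap.mul' A A ∘ₗ TensorProduct.map (evalVec X) (evalVec Y)

/-- The contraction `( , ) : Ω¹ ⊗ Ω¹ → A`, `ω ⊗ η ↦ (ω, η)`. -/
def contract {A : Type*} [CommRing A] [Algebra ℝ A] {δ : Forms A →ₗ[ℝ] Forms A}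
    (hδ : IsSymmetricCodifferential δ) : OneOneForm A →ₗ[A] A :=
  TensorProduct.lift (pairing hδ)

/-- `g = ∑ᵢ αᵢ ⊗ βᵢ` is inverse to `( , )`:
`∑ᵢ (ω, αᵢ) βᵢ = ω = ∑ᵢ (βᵢ, ω) αᵢ` for every `1`-form `ω`. -/
def IsInverseMetric {A : Type*} [CommRing A] [Algebra ℝ A] {δ : Forms A →ₗ[ℝ] Forms A}
    (hδ : IsSymmetricCodifferential δ) (g : OneOneForm A) : Prop :=
  ∀ ω : Form A 1,
    TensorProduct.lid A (Form A 1) ((pairing hδ ω).rTensor (Form A 1) g) = ω ∧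
    TensorProduct.rid A (Form A 1) (((pairing hδ).flip ω).lTensor (Form A 1) g) = ω

/-- The `1`-form `X^♭ = g(X, ·)` of a vector field. -/
def flat {A : Type*} [CommRing A] [Algebra ℝ A] (g : OneOneForm A) (X : VecField A) : Form A 1 :=
  TensorProduct.lid A (Form A 1) ((evalVec X).rTensor (Form A 1) g)

/-- The covariant derivative `∇_X Y` of vector fields. -/
def nablaVec {A : Type*} [CommRing A] [Algebra ℝ A] {δ : Forms A →ₗ[ℝ] Forms A}
    (hδ : IsSymmetricCodifferential δ) (g : OneOneForm A) (X Y : VecField A) : VecField A :=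
  sharp hδ (nabla hδ (flat g X) (flat g Y))

/-- The curvature `R(X, Y)Z = ∇_X ∇_Y Z - ∇_Y ∇_X Z - ∇_{[X, Y]} Z`. -/
def curvature {A : Type*} [CommRing A] [Algebra ℝ A] {δ : Forms A →ₗ[ℝ] Forms A}
    (hδ : IsSymmetricCodifferential δ) (g : OneOneForm A) (X Y Z : VecField A) : VecField A :=
  nablaVec hδ g X (nablaVec hδ g Y Z) - nablaVec hδ g Y (nablaVec hδ g X Z)
    - nablaVec hδ g ⁅X, Y⁆ Z

/-- The Ricci tensor `Ricci(Y, Z) = tr (X ↦ R(X, Y)Z)`. When the metric `g = ∑ᵢ αᵢ ⊗ βᵢ` is inverse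
to `( , )`, the vector fields `βᵢ^*` and the `1`-forms `αᵢ` satisfy `X = ∑ᵢ αᵢ(X) βᵢ^*`, so that the
trace of an `A`-linear map `T` of vector fields is `∑ᵢ αᵢ(T(βᵢ^*))`. -/
def ricci {A : Type*} [CommRing A] [Algebra ℝ A] {δ : Forms A →ₗ[ℝ] Forms A}
    (hδ : IsSymmetricCodifferential δ) {m : ℕ} (α β : Fin m → Form A 1) (Y Z : VecField A) : A :=
  ∑ i, α i ![curvature hδ (∑ j, α j ⊗ₜ[A] β j) (sharp hδ (β i)) Y Z]

/-- The scalar curvature: the trace of the Ricci tensor with respect to the metric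
`g = ∑ᵢ αᵢ ⊗ βᵢ`. -/
def scalarCurvature {A : Type*} [CommRing A] [Algebra ℝ A] {δ : Forms A →ₗ[ℝ] Forms A}
    (hδ : IsSymmetricCodifferential δ) {m : ℕ} (α β : Fin m → Form A 1) : A :=
  ∑ i, ricci hδ α β (sharp hδ (α i)) (sharp hδ (β i))

/-- The Einstein tensor `Ricci - ½ S g`. -/
def einstein {A : Type*} [CommRing A] [Algebra ℝ A] {δ : Forms A →ₗ[ℝ] Forms A}
    (hδ : IsSymmetricCodifferential δ) {m : ℕ} (α β : Fin m → Form A 1) (Y Z : VecField A) : A :=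
  ricci hδ α β Y Z
    - (1 / 2 : ℝ) • (scalarCurvature hδ α β * evalTensor Y Z (∑ j, α j ⊗ₜ[A] β j))

/-- `δ` is the divergence (codifferential) of the geometry that it determines:
`δω = ∑ᵢ (αᵢ, ∇_{βᵢ} ω)`, the trace of `∇ω`, where `g = ∑ᵢ αᵢ ⊗ βᵢ`. -/
def IsDivergence {A : Type*} [CommRing A] [Algebra ℝ A] {δ : Forms A →ₗ[ℝ] Forms A}
    (hδ : IsSymmetricCodifferential δ) (g : OneOneForm A) : Prop :=
  ∀ (m : ℕ) (α β : Fin m → Form A 1), g = ∑ i, α i ⊗ₜ[A] β i →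
    ∀ ω : Form A 1, codiff₁ δ ω = ∑ i, pairing hδ (α i) (nabla hδ (β i) ω)

/-- `L` is the extension of the Hodge Laplacian to `1`-`1`-forms by the second-order Leibniz rule
`L(ω ⊗ η) = Δω ⊗ η + ω ⊗ Δη + 2 ∑ᵢ ∇_{αᵢ} ω ⊗ ∇_{βᵢ} η`, for every way of writing
`g = ∑ᵢ αᵢ ⊗ βᵢ`. -/
def IsHodgeExtension {A : Type*} [CommRing A] [Algebra ℝ A] {δ : Forms A →ₗ[ℝ] Forms A}
    (hδ : IsSymmetricCodifferential δ) (g : OneOneForm A)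
    (L : OneOneForm A →ₗ[ℝ] OneOneForm A) : Prop :=
  ∀ (m : ℕ) (α β : Fin m → Form A 1), g = ∑ i, α i ⊗ₜ[A] β i → ∀ ω η : Form A 1,
    L (ω ⊗ₜ[A] η) = hodgeLaplacian δ ω ⊗ₜ[A] η + ω ⊗ₜ[A] hodgeLaplacian δ η
      + (2 : ℝ) • ∑ i, nabla hδ (α i) ω ⊗ₜ[A] nabla hδ (β i) η

end DerivationForms

end

/-! The argument is purely algebraic over `A`. Writing g = ∑ αᵢ ⊗ βᵢ makes αᵢ and βᵢ^* dual: X = ∑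
αᵢ(X) βᵢ^* for every vector field. Hence every functional on 1-forms is evaluation at a vector
field, and an `A`-linear functional that kills exact forms is zero
(`IsInverseMetric.functional_eq_zero`). Tensorial identities therefore need checking only on exact
forms.

The six-term relation says that δ is a second-order operator. Together with δ² = 0 it turns the
first three terms of ∇ into the commutator of vector fields (`sharp_bracket`). The remaining terms
are those of the Koszul formula, so ∇ is the Levi-Civita connection. It also gives Δ(aω) = aΔω +
2∇_{da}ω + (δda)ω, which is exactly what makes the second-order Leibniz expression balanced over
`A`. Existence in (1) follows; uniqueness holds because pure tensors span.

For (2), when δ is the divergence, the trace of ∇² obeys the same Leibniz rule as Δ. Their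
difference is then `A`-linear, and Bochner's formula on exact forms identifies it as minus the Ricci
tensor (`IsInverseMetric.hodgeLaplacian_apply`). Applied to g, the second-derivative and cross terms
assemble to the rough Laplacian of g, which vanishes because ∇g = 0. Each tensor factor leaves one
copy of -Ricci, so Δg = -2 Ricci; the other two identities are its trace and a rearrangement. -/

namespace DerivationForms

/-! ### Exterior products and derivatives in low degree. -/

variable {A : Type*} [CommRing A] [Algebra ℝ A]

/-- Alternating the tensor product counts each shuffle p! q! times, so when this number is 1 the
shuffles may be replaced by all permutations. -/
theorem wedgePQ_apply_of_factorial_eq_one {p q : ℕ} (hp : p.factorial = 1) (hq : q.factorial = 1)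
    (ω : Form A p) (η : Form A q) (v : Fin (p + q) → VecField A) :
    wedgePQ (A := A) p q ω η v = ∑ σ : Equiv.Perm (Fin p ⊕ Fin q),
      Equiv.Perm.sign σ • (ω (fun i => v (finSumFinEquiv (σ (Sum.inl i)))) *
        η (fun j => v (finSumFinEquiv (σ (Sum.inr j))))) := by
  have h := MultilinearMap.domCoprod_alternization_eq ω η
  simp only [Fintype.card_fin, hp, hq, mul_one, one_smul] at h
  simp only [wedgePQ, LinearMap.mk₂_apply, AlternatingMap.domDomCongr_apply,
    LinearMap.compAlternatingMap_apply, ← h, MultilinearMap.alternatization_apply, map_sum,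
    Units.smul_def, map_zsmul, MultilinearMap.domDomCongr_apply, MultilinearMap.domCoprod_apply,
    LinearMap.mul'_apply, Function.comp_apply]
  rfl

theorem wedgePQ_zero_one (a : A) (η : Form A 1) (X : VecField A) :
    wedgePQ (A := A) 0 1 (funForm a) η ![X] = a * η ![X] := by
  have hu : (Finset.univ : Finset (Equiv.Perm (Fin 0 ⊕ Fin 1))) = {1} := by decide
  rw [wedgePQ_apply_of_factorial_eq_one rfl rfl, hu, Finset.sum_singleton]
  have e (v : Fin 1 → VecField A) : v = ![v 0] := by
    ext i
    fin_cases i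
    rfl
  rw [Equiv.Perm.sign_one, one_smul, e (fun j => ![X] _)]
  rfl

theorem wedgePQ_one_one (ω η : Form A 1) (X Y : VecField A) :
    wedgePQ (A := A) 1 1 ω η ![X, Y] = ω ![X] * η ![Y] - ω ![Y] * η ![X] := by
  rw [wedgePQ_apply_of_factorial_eq_one rfl rfl]
  have hu : (Finset.univ : Finset (Equiv.Perm (Fin 1 ⊕ Fin 1))) =
      {1, Equiv.swap (Sum.inl 0) (Sum.inr 0)} := by decide
  have hne : (1 : Equiv.Perm (Fin 1 ⊕ Fin 1)) ≠ Equiv.swap (Sum.inl 0) (Sum.inr 0) := by decide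
  rw [hu, Finset.sum_pair hne, Equiv.Perm.sign_swap (by decide)]
  have e (v : Fin 1 → VecField A) : v = ![v 0] := by
    ext i
    fin_cases i
    rfl
  simp only [Equiv.Perm.sign_one, one_smul, Units.smul_def, Units.val_neg, Units.val_one, neg_smul,
    ← sub_eq_add_neg]
  congr 2
  · rw [e (fun i => _)]; rfl
  · rw [e (fun i => _)]; rfl
  · rw [e (fun i => _)]; rfl
  · rw [e (fun i => _)]; rfl

theorem form_one_ext {ω η : Form A 1} (h : ∀ X, ω ![X] = η ![X]) : ω = η := by
  ext v
  have e : v = ![v 0] := by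
    ext i
    fin_cases i
    rfl
  rw [e]
  exact h _

theorem form_two_ext {ω η : Form A 2} (h : ∀ X Y, ω ![X, Y] = η ![X, Y]) : ω = η := by
  ext v
  have e : v = ![v 0, v 1] := by
    ext i
    fin_cases i <;> rfl
  rw [e]
  exact h _ _

theorem funForm_surjective (f : Form A 0) : f = funForm (f ![]) := by
  ext v
  rw [Subsingleton.elim v ![]]
  rfl

theorem wedge_funForm_one (a : A) (η : Form A 1) :
    wedge (incl 0 (funForm a)) (incl 1 η) = incl 1 (a • η) := by
  refine (wedge_incl (A := A) (funForm a) η).trans (congrArg (incl 1) ?_)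
  exact form_one_ext fun X => wedgePQ_zero_one a η X

theorem form_two_swap (θ : Form A 2) (X Y : VecField A) : θ ![Y, X] = -θ ![X, Y] := by
  have h := θ.map_swap ![X, Y] (i := 0) (j := 1) (by decide)
  rw [← h]
  congr 1
  ext i
  fin_cases i <;> rfl

theorem wedgePQ_swap (ω η : Form A 1) :
    wedgePQ (A := A) 1 1 η ω = -wedgePQ (A := A) 1 1 ω η := by
  refine form_two_ext fun X Y => ?_
  rw [AlternatingMap.neg_apply, wedgePQ_one_one, wedgePQ_one_one]
  ring

@[simp]
theorem d₀_apply (a : A) (X : VecField A) : d₀ a ![X] = X a := rfl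

@[simp]
theorem d₁_apply (ω : Form A 1) (X Y : VecField A) :
    d₁ ω ![X, Y] = X (ω ![Y]) - Y (ω ![X]) - ω ![⁅X, Y⁆] := rfl

theorem d₀_add (a b : A) : d₀ (a + b) = d₀ a + d₀ b :=
  form_one_ext fun X => by simp

theorem d₀_mul (a b : A) : d₀ (a * b) = a • d₀ b + b • d₀ a :=
  form_one_ext fun X => by simp

theorem d₁_d₀ (a : A) : d₁ (d₀ a) = 0 :=
  form_two_ext fun X Y => by simp [Derivation.commutator_apply]

theorem d₁_add (ω η : Form A 1) : d₁ (ω + η) = d₁ ω + d₁ η :=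
  form_two_ext fun X Y => by simp; ring

theorem d₁_smul (a : A) (ω : Form A 1) : d₁ (a • ω) = wedgePQ (A := A) 1 1 (d₀ a) ω + a • d₁ ω :=
  form_two_ext fun X Y => by
    rw [AlternatingMap.add_apply, wedgePQ_one_one]
    simp
    ring

/-! ### The codifferential on 1- and 2-forms, and its bracket. -/

variable {δ : Forms A →ₗ[ℝ] Forms A} (hδ : IsSymmetricCodifferential δ)

theorem incl_codiff₁ (hδ : IsSymmetricCodifferential δ) (ω : Form A 1) :
    δ (incl 1 ω) = incl 0 (funForm (codiff₁ δ ω)) := by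
  obtain ⟨η, h⟩ := hδ.map_succ_form 0 ω
  have : codiff₁ δ ω = η ![] := by
    rw [codiff₁, show δ (incl 1 ω) = incl 0 η from h]
    exact congrArg (fun f : Form A 0 => f ![]) (DirectSum.lof_apply A 0 η)
  rw [this, ← funForm_surjective]
  exact h

theorem incl_codiff₂ (hδ : IsSymmetricCodifferential δ) (θ : Form A 2) :
    δ (incl 2 θ) = incl 1 (codiff₂ δ θ) := by
  obtain ⟨η, h⟩ := hδ.map_succ_form 1 θ
  have : codiff₂ δ θ = η := by
    rw [codiff₂, show δ (incl 2 θ) = incl 1 η from h]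
    exact DirectSum.lof_apply A 1 η
  rw [this]
  exact h

theorem codiff₂_add (δ : Forms A →ₗ[ℝ] Forms A) (θ θ' : Form A 2) :
    codiff₂ δ (θ + θ') = codiff₂ δ θ + codiff₂ δ θ' := by
  simp [codiff₂]

theorem codiff₁_zero (δ : Forms A →ₗ[ℝ] Forms A) : codiff₁ δ 0 = 0 := by
  simp [codiff₁]

theorem codiff₂_zero (δ : Forms A →ₗ[ℝ] Forms A) : codiff₂ δ 0 = 0 := by
  simp [codiff₂]

theorem codiff₁_sub (δ : Forms A →ₗ[ℝ] Forms A) (ω η : Form A 1) :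
    codiff₁ δ (ω - η) = codiff₁ δ ω - codiff₁ δ η := by
  rw [eq_sub_iff_add_eq, ← codiff₁_add, sub_add_cancel]

theorem codiff₂_neg (δ : Forms A →ₗ[ℝ] Forms A) (θ : Form A 2) :
    codiff₂ δ (-θ) = -codiff₂ δ θ := by
  rw [eq_neg_iff_add_eq_zero, ← codiff₂_add, neg_add_cancel, codiff₂_zero]

include hδ in
theorem codiff₁_codiff₂ (θ : Form A 2) : codiff₁ δ (codiff₂ δ θ) = 0 := by
  have h := hδ.sq_zero (incl 2 θ)
  rw [incl_codiff₂ hδ] at h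
  simp [codiff₁, h]

theorem codiff₁_smul (a : A) (ω : Form A 1) :
    codiff₁ δ (a • ω) = a * codiff₁ δ ω + pairing hδ ω (d₀ a) := by
  rw [pairing_d₀]
  ring

theorem sharp_apply (a : A) (ω : Form A 1) : sharp hδ ω a = pairing hδ ω (d₀ a) := rfl

theorem pairing_apply (ω η : Form A 1) : pairing hδ ω η = η ![sharp hδ ω] := rfl

/-- The six-term relation for two 1-forms: the differences δ(aω) - aδω and δ(aη) - aδη that occur in
it are the pairings with da. -/
theorem codiff₂_smul_wedgePQ (a : A) (ω η : Form A 1) :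
    codiff₂ δ (a • wedgePQ (A := A) 1 1 ω η) = a • codiff₂ δ (wedgePQ (A := A) 1 1 ω η)
      + pairing hδ ω (d₀ a) • η - pairing hδ η (d₀ a) • ω := by
  have h := hδ.six_term a 1 ω (incl 1 η)
  have e (k : ℕ) (a : A) (ω : Form A k) : a • incl k ω = incl k (a • ω) := (map_smul _ _ _).symm
  have e2 (x : Form A 2) : incl (1 + 1) x = incl 2 x := rfl
  rw [wedge_incl, e2, e, e, e, incl_codiff₂ hδ, incl_codiff₂ hδ, incl_codiff₁ hδ, incl_codiff₁ hδ,
    incl_codiff₁ hδ, incl_codiff₁ hδ, wedge_funForm, wedge_funForm, wedge_funForm_one,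
    wedge_funForm_one, e, e, e, e] at h
  have h' := congrArg (fun x : Forms A => x 1) h
  have l (x : Form A 1) : (incl 1 x : Forms A) 1 = x := DirectSum.lof_apply A 1 x
  simp only [DirectSum.add_apply, DirectSum.sub_apply, DirectSum.smul_apply, e, l,
    DirectSum.zero_apply, pow_one] at h'
  rw [codiff₁_smul hδ, codiff₁_smul hδ] at h'
  have h'' := congrArg (fun z => z + (a • codiff₂ δ (wedgePQ (A := A) 1 1 ω η)
      + pairing hδ ω (d₀ a) • η - pairing hδ η (d₀ a) • ω)) h'
  simp only [zero_add] at h''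
  rw [← h'', neg_one_smul, neg_one_smul]
  module

/-- Apply δ to the expansion of δ(aωη). By δ² = 0 only first-order terms survive, and they compare
the two vector fields on the function a. -/
theorem sharp_bracket (ω η : Form A 1) :
    sharp hδ (codiff₂ δ (wedgePQ (A := A) 1 1 ω η) - codiff₁ δ ω • η + codiff₁ δ η • ω) =
      ⁅sharp hδ ω, sharp hδ η⁆ := by
  ext a
  have h := congrArg (codiff₁ δ) (codiff₂_smul_wedgePQ hδ a ω η)
  rw [codiff₁_codiff₂ hδ, codiff₁_sub, codiff₁_add, codiff₁_smul hδ, codiff₁_codiff₂ hδ,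
    codiff₁_smul hδ, codiff₁_smul hδ] at h
  rw [Derivation.commutator_apply]
  simp only [map_add, map_sub, map_smul, Derivation.add_apply, Derivation.sub_apply,
    Derivation.smul_apply, smul_eq_mul, sharp_apply]
  linear_combination -h

end DerivationForms

/-! ### Consequences of nondegeneracy. -/

namespace DerivationForms

instance {A : Type*} [CommRing A] [Algebra ℝ A] (k : ℕ) : IsScalarTower ℝ A (Form A k) where
  smul_assoc r a ω := by
    ext v
    simp

theorem half_smul_sub_half_smul {E : Type*} [AddCommGroup E] [Module ℝ E] {x y z : E}
    (h : x - y = z + z) : (1 / 2 : ℝ) • x - (1 / 2 : ℝ) • y = z := by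
  rw [← smul_sub, h]
  module

section InverseMetric

variable {A : Type*} [CommRing A] [Algebra ℝ A] {δ : Forms A →ₗ[ℝ] Forms A}
  {hδ : IsSymmetricCodifferential δ} {m : ℕ} {α β : Fin m → Form A 1}

theorem IsInverseMetric.left_expand (hg : IsInverseMetric hδ (∑ i, α i ⊗ₜ[A] β i))
    (ω : Form A 1) : ∑ i, pairing hδ ω (α i) • β i = ω := by
  simpa [map_sum] using (hg ω).1

theorem IsInverseMetric.right_expand (hg : IsInverseMetric hδ (∑ i, α i ⊗ₜ[A] β i))
    (ω : Form A 1) : ∑ i, pairing hδ (β i) ω • α i = ω := by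
  simpa [map_sum] using (hg ω).2

theorem evalVec_apply (X : VecField A) (ω : Form A 1) : evalVec X ω = ω ![X] := rfl

theorem form_zero_vec (ω : Form A 1) : ω ![(0 : VecField A)] = 0 := by
  simpa using form_smul ω 0 0

theorem form_sum_vec {ι : Type*} (s : Finset ι) (ω : Form A 1) (X : ι → VecField A) :
    ω ![∑ i ∈ s, X i] = ∑ i ∈ s, ω ![X i] := by
  classical
  induction s using Finset.induction_on with
  | empty => simp [form_zero_vec]
  | insert a s ha ih => rw [Finset.sum_insert ha, Finset.sum_insert ha, form_add, ih]

theorem form_sum_apply {ι : Type*} {k : ℕ} (s : Finset ι) (ω : ι → Form A k)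
    (v : Fin k → VecField A) : (∑ i ∈ s, ω i) v = ∑ i ∈ s, ω i v := by
  classical
  induction s using Finset.induction_on with
  | empty => simp
  | insert a s ha ih => rw [Finset.sum_insert ha, Finset.sum_insert ha, AlternatingMap.add_apply, ih]

/-- A linear functional on `1`-forms that vanishes on exact forms is zero: it is the evaluation at
a derivation. -/
theorem IsInverseMetric.functional_eq_zero (hg : IsInverseMetric hδ (∑ i, α i ⊗ₜ[A] β i))
    (φ : Form A 1 →ₗ[A] A) (hφ : ∀ a, φ (d₀ a) = 0) : φ = 0 := by
  have h (ω : Form A 1) : φ ω = ω ![∑ i, φ (α i) • sharp hδ (β i)] := by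
    conv_lhs => rw [← hg.right_expand ω]
    simp only [map_sum, map_smul, form_sum_vec, form_smul, smul_eq_mul, pairing_apply, mul_comm]
  have h0 : ∑ i, φ (α i) • sharp hδ (β i) = 0 := by
    ext a
    rw [← d₀_apply a, ← h, hφ]
    rfl
  ext ω
  rw [h, h0, form_zero_vec]
  rfl

/-- The symmetry hypothesis concerns pairs of exact forms only; `functional_eq_zero` removes
exactness from one argument at a time. -/
theorem IsInverseMetric.pairing_comm (hg : IsInverseMetric hδ (∑ i, α i ⊗ₜ[A] β i))
    (ω η : Form A 1) : pairing hδ ω η = pairing hδ η ω := by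
  have h1 (a : A) : pairing hδ (d₀ a) - (pairing hδ).flip (d₀ a) = 0 :=
    hg.functional_eq_zero _ fun b => by
      rw [LinearMap.sub_apply, LinearMap.flip_apply, pairing_d₀, pairing_d₀, sub_eq_zero]
      have h := congrArg (fun x : Forms A => x 0 ![]) (hδ.symm b a)
      simp only [DirectSum.sub_apply, DirectSum.smul_apply, AlternatingMap.sub_apply,
        AlternatingMap.smul_apply, smul_eq_mul] at h
      simpa only [codiff₁, map_smul] using h
  have h2 : (pairing hδ).flip η - pairing hδ η = 0 :=
    hg.functional_eq_zero _ fun a => LinearMap.congr_fun (h1 a) η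
  exact sub_eq_zero.1 (LinearMap.congr_fun h2 ω)

/-- A derivation is determined by its values X(a) = (da)(X), so it suffices to expand da. -/
theorem IsInverseMetric.vec_expand (hg : IsInverseMetric hδ (∑ i, α i ⊗ₜ[A] β i))
    (X : VecField A) : ∑ i, α i ![X] • sharp hδ (β i) = X := by
  ext a
  have h := congrArg (fun ω : Form A 1 => ω ![X]) (hg.right_expand (d₀ a))
  simp only [form_sum_apply, AlternatingMap.smul_apply, smul_eq_mul, d₀_apply] at h
  rw [← h, ← Derivation.coeFnAddMonoidHom_apply, map_sum, Finset.sum_apply]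
  exact Finset.sum_congr rfl fun i _ => mul_comm _ _

theorem interior_apply (ω : Form A 1) (θ : Form A 2) (X : VecField A) :
    interior hδ ω θ ![X] = θ ![sharp hδ ω, X] := rfl

theorem interior_wedgePQ (ω η ζ : Form A 1) :
    interior hδ ω (wedgePQ (A := A) 1 1 η ζ) = pairing hδ ω η • ζ - pairing hδ ω ζ • η :=
  form_one_ext fun X => by
    rw [interior_apply, wedgePQ_one_one]
    simp only [AlternatingMap.sub_apply, AlternatingMap.smul_apply, smul_eq_mul, pairing_apply]
    ring

theorem interior_add (ω : Form A 1) (θ θ' : Form A 2) :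
    interior hδ ω (θ + θ') = interior hδ ω θ + interior hδ ω θ' := rfl

theorem interior_smul (a : A) (ω : Form A 1) (θ : Form A 2) :
    interior hδ ω (a • θ) = a • interior hδ ω θ := rfl

theorem interior_zero (ω : Form A 1) : interior hδ ω 0 = 0 := rfl

theorem interior_add_left (ω η : Form A 1) (θ : Form A 2) :
    interior hδ (ω + η) θ = interior hδ ω θ + interior hδ η θ := by
  rw [interior, map_add, map_add]
  rfl

theorem interior_smul_left (a : A) (ω : Form A 1) (θ : Form A 2) :
    interior hδ (a • ω) θ = a • interior hδ ω θ := by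
  rw [interior, map_smul, map_smul]
  rfl

/-- Every `2`-form is a sum of products of `1`-forms. -/
theorem IsInverseMetric.form_two_induction (hg : IsInverseMetric hδ (∑ i, α i ⊗ₜ[A] β i))
    {P : Form A 2 → Prop} (h0 : P 0) (hadd : ∀ θ θ', P θ → P θ' → P (θ + θ'))
    (hw : ∀ ω η : Form A 1, P (wedgePQ (A := A) 1 1 ω η)) (θ : Form A 2) : P θ := by
  -- The factor ½ is the inverse of the degree: ∑ αᵢ ∧ 𝔦_{βᵢ} θ = 2θ.
  have e : θ = ∑ i, wedgePQ (A := A) 1 1 ((1 / 2 : ℝ) • α i) (interior hδ (β i) θ) := by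
    refine form_two_ext fun X Y => ?_
    have c (Z : VecField A) (ω : Form A 1) :
        ∑ i, α i ![Z] * ω ![sharp hδ (β i)] = ω ![Z] := by
      conv_rhs => rw [← hg.vec_expand Z, form_sum_vec]
      simp only [form_smul]
    have c1 := c X (θ.curryLeft Y)
    have c2 := c Y (θ.curryLeft X)
    have l : (∑ i, wedgePQ (A := A) 1 1 ((1 / 2 : ℝ) • α i) (interior hδ (β i) θ)) ![X, Y] =
        ∑ i, (1 / 2 : ℝ) • (α i ![Y] * θ.curryLeft X ![sharp hδ (β i)] -
          α i ![X] * θ.curryLeft Y ![sharp hδ (β i)]) := by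
      refine (form_sum_apply (k := 2) _ _ _).trans ?_
      refine Finset.sum_congr rfl fun i _ => ?_
      rw [wedgePQ_one_one, interior_apply, interior_apply, form_two_swap θ Y, form_two_swap θ X]
      simp only [AlternatingMap.smul_apply, smul_mul_assoc, ← smul_sub]
      congr 1
      change _ = α i ![Y] * θ ![X, sharp hδ (β i)] - α i ![X] * θ ![Y, sharp hδ (β i)]
      ring
    rw [l, ← Finset.smul_sum, Finset.sum_sub_distrib, c1, c2]
    change _ = (1 / 2 : ℝ) • (θ ![X, Y] - θ ![Y, X])
    rw [form_two_swap θ X Y]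
    module
  rw [e]
  exact Finset.sum_induction _ P hadd h0 fun i _ => hw _ _

/-- Known on products of 1-forms, which span the 2-forms; both sides are additive. -/
theorem IsInverseMetric.codiff₂_smul (hg : IsInverseMetric hδ (∑ i, α i ⊗ₜ[A] β i))
    (a : A) (θ : Form A 2) :
    codiff₂ δ (a • θ) = a • codiff₂ δ θ + interior hδ (d₀ a) θ := by
  induction θ using hg.form_two_induction with
  | h0 => rw [smul_zero, codiff₂_zero, smul_zero, interior_zero, zero_add]
  | hadd θ θ' h h' =>
    rw [smul_add, codiff₂_add, codiff₂_add, h, h', interior_add]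
    module
  | hw ω η =>
    rw [codiff₂_smul_wedgePQ hδ, interior_wedgePQ, hg.pairing_comm (d₀ a), hg.pairing_comm (d₀ a)]
    module

/-! ### The Levi-Civita property of `∇` -/

/-- All terms in da cancel: (ω, da)η between δ(aωη) and δ(aω)η, (η, da)ω between δ(aωη) and 𝔦_η(da ∧
ω), and (ω, η)da between the latter and d(a(ω, η)). -/
theorem IsInverseMetric.nabla_smul_left (hg : IsInverseMetric hδ (∑ i, α i ⊗ₜ[A] β i))
    (a : A) (ω η : Form A 1) : nabla hδ (a • ω) η = a • nabla hδ ω η := by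
  rw [nabla, nabla, map_smul, map_smul, LinearMap.smul_apply, LinearMap.smul_apply,
    codiff₂_smul_wedgePQ hδ, codiff₁_smul hδ, d₁_smul, interior_add, interior_smul,
    interior_smul_left, interior_wedgePQ, smul_eq_mul, d₀_mul, smul_comm a (1 / 2 : ℝ),
    hg.pairing_comm η ω]
  congr 1
  module

/-- Here (ω, da)η survives twice, from δ(aωη) and from 𝔦_ω(da ∧ η), which the factor ½ halves. -/
theorem nabla_smul_right
    (a : A) (ω η : Form A 1) :
    nabla hδ ω (a • η) = a • nabla hδ ω η + pairing hδ ω (d₀ a) • η := by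
  rw [nabla, nabla, map_smul, map_smul,
    codiff₂_smul_wedgePQ hδ, codiff₁_smul hδ, d₁_smul, interior_add, interior_smul,
    interior_smul_left, interior_wedgePQ, smul_eq_mul, d₀_mul, smul_comm a (1 / 2 : ℝ)]
  rw [← sub_eq_iff_eq_add']
  exact half_smul_sub_half_smul (by module)

theorem nabla_add_left (ω ω' η : Form A 1) :
    nabla hδ (ω + ω') η = nabla hδ ω η + nabla hδ ω' η := by
  rw [nabla, nabla, nabla, map_add, map_add, LinearMap.add_apply, LinearMap.add_apply,
    codiff₂_add, codiff₁_add, d₁_add, interior_add, interior_add_left, d₀_add, ← smul_add]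
  congr 1
  module

theorem nabla_add_right (ω η η' : Form A 1) :
    nabla hδ ω (η + η') = nabla hδ ω η + nabla hδ ω η' := by
  rw [nabla, nabla, nabla, map_add, map_add,
    codiff₂_add, codiff₁_add, d₁_add, interior_add, interior_add_left, d₀_add, ← smul_add]
  congr 1
  module

/-- The last three terms of ∇ are symmetric in ω and η, so the antisymmetric part is the bracket
alone: ∇ is torsion-free. -/
theorem IsInverseMetric.sharp_nabla_sub (hg : IsInverseMetric hδ (∑ i, α i ⊗ₜ[A] β i))
    (ω η : Form A 1) :
    sharp hδ (nabla hδ ω η) - sharp hδ (nabla hδ η ω) = ⁅sharp hδ ω, sharp hδ η⁆ := by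
  rw [← sharp_bracket, ← map_sub, nabla, nabla, wedgePQ_swap ω η, codiff₂_neg,
    hg.pairing_comm η ω]
  congr 1
  exact half_smul_sub_half_smul (by module)

/-- The Koszul formula. The codifferential terms of ∇ give [ω^*, η^*], and the interior products
expand through the definition of the exterior derivative. -/
theorem IsInverseMetric.two_smul_pairing_nabla (hg : IsInverseMetric hδ (∑ i, α i ⊗ₜ[A] β i))
    (ω η ζ : Form A 1) :
    (2 : ℝ) • pairing hδ (nabla hδ ω η) ζ =
      sharp hδ ω (pairing hδ η ζ) + sharp hδ η (pairing hδ ω ζ) - sharp hδ ζ (pairing hδ ω η)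
      + ζ ![⁅sharp hδ ω, sharp hδ η⁆] - η ![⁅sharp hδ ω, sharp hδ ζ⁆]
      - ω ![⁅sharp hδ η, sharp hδ ζ⁆] := by
  have h := sharp_bracket hδ ω η
  rw [nabla, LinearMap.map_smul_of_tower, LinearMap.smul_apply, smul_smul]
  norm_num
  rw [← h, ← pairing_apply]
  simp only [hg.pairing_comm _ ζ, map_add, map_sub]
  simp only [pairing_apply hδ ζ, interior_apply, d₁_apply, d₀_apply]
  simp only [← pairing_apply, hg.pairing_comm ζ]
  simp only [LinearMap.add_apply, LinearMap.sub_apply, map_smul, LinearMap.smul_apply, smul_eq_mul,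
    hg.pairing_comm η ω]
  ring

end InverseMetric

end DerivationForms

/-! ### Levi-Civita connections: curvature, traces, Bochner's formula. -/

namespace DerivationForms

section LeviCivita

variable {A : Type*} [CommRing A] [Algebra ℝ A]

/-- `D` is the Levi-Civita connection of the symmetric bilinear form `G`. -/
structure IsLeviCivita (G : VecField A →ₗ[A] VecField A →ₗ[A] A)
    (D : VecField A → VecField A → VecField A) : Prop where
  symm : ∀ X Y, G X Y = G Y X
  add_left : ∀ X Y Z, D (X + Y) Z = D X Z + D Y Z
  smul_left : ∀ (a : A) X Z, D (a • X) Z = a • D X Z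
  add_right : ∀ X Y Z, D X (Y + Z) = D X Y + D X Z
  smul_right : ∀ (a : A) X Z, D X (a • Z) = a • D X Z + X a • Z
  torsion : ∀ X Y, D X Y - D Y X = ⁅X, Y⁆
  metric : ∀ X Y Z, X (G Y Z) = G (D X Y) Z + G Y (D X Z)

/-- `E` and `F` are dual frames for the bilinear form `G`. -/
structure IsDualFrame (G : VecField A →ₗ[A] VecField A →ₗ[A] A) {m : ℕ}
    (E F : Fin m → VecField A) : Prop where
  left_expand : ∀ X, ∑ i, G X (F i) • E i = X
  right_expand : ∀ X, ∑ i, G X (E i) • F i = X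

/-- The second covariant derivative `∇²_{X, Y} Z`. -/
def sndDeriv (D : VecField A → VecField A → VecField A) (X Y Z : VecField A) : VecField A :=
  D X (D Y Z) - D (D X Y) Z

/-- The curvature of a connection. -/
def curvatureOf (D : VecField A → VecField A → VecField A) (X Y Z : VecField A) : VecField A :=
  D X (D Y Z) - D Y (D X Z) - D ⁅X, Y⁆ Z

/-- The trace of the second covariant derivative. -/
def roughLaplacian (D : VecField A → VecField A → VecField A) {m : ℕ} (E F : Fin m → VecField A)
    (Z : VecField A) : VecField A :=
  ∑ i, sndDeriv D (E i) (F i) Z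

/-- The Ricci tensor of a connection in terms of dual frames. -/
def ricciOf (G : VecField A →ₗ[A] VecField A →ₗ[A] A)
    (D : VecField A → VecField A → VecField A) {m : ℕ} (E F : Fin m → VecField A)
    (Y Z : VecField A) : A :=
  ∑ i, G (curvatureOf D (E i) Y Z) (F i)

variable {G : VecField A →ₗ[A] VecField A →ₗ[A] A} {D : VecField A → VecField A → VecField A}
  {m : ℕ} {E F : Fin m → VecField A}

namespace IsLeviCivita

theorem sub_left (h : IsLeviCivita G D) (X Y Z : VecField A) : D (X - Y) Z = D X Z - D Y Z := by
  rw [eq_sub_iff_add_eq, ← h.add_left, sub_add_cancel]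

theorem sub_right (h : IsLeviCivita G D) (X Y Z : VecField A) :
    D X (Y - Z) = D X Y - D X Z := by
  rw [eq_sub_iff_add_eq, ← h.add_right, sub_add_cancel]

theorem sum_left (h : IsLeviCivita G D) {ι : Type*} (s : Finset ι) (X : ι → VecField A)
    (Z : VecField A) : D (∑ i ∈ s, X i) Z = ∑ i ∈ s, D (X i) Z :=
  map_sum (AddMonoidHom.mk' (fun X => D X Z) fun X Y => h.add_left X Y Z) X s

theorem curvature_swap (h : IsLeviCivita G D) (X Y Z : VecField A) :
    curvatureOf D Y X Z = -curvatureOf D X Y Z := by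
  have e : D ⁅Y, X⁆ Z = -D ⁅X, Y⁆ Z := by
    rw [eq_neg_iff_add_eq_zero, ← h.add_left, ← lie_skew, neg_add_cancel]
    simpa using h.smul_left 0 0 Z
  rw [curvatureOf, curvatureOf, e]
  abel

theorem curvature_eq (h : IsLeviCivita G D) (X Y Z : VecField A) :
    curvatureOf D X Y Z = sndDeriv D X Y Z - sndDeriv D Y X Z := by
  rw [curvatureOf, sndDeriv, sndDeriv, ← h.torsion, h.sub_left]
  abel

theorem curvature_add_right (h : IsLeviCivita G D) (X Y Z Z' : VecField A) :
    curvatureOf D X Y (Z + Z') = curvatureOf D X Y Z + curvatureOf D X Y Z' := by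
  simp only [curvatureOf, h.add_right]
  abel

theorem curvature_smul_right (h : IsLeviCivita G D) (a : A) (X Y Z : VecField A) :
    curvatureOf D X Y (a • Z) = a • curvatureOf D X Y Z := by
  simp only [curvatureOf, h.add_right, h.smul_right, Derivation.commutator_apply]
  module

/-- The Jacobi identity, with each bracket rewritten by vanishing torsion. -/
theorem curvature_bianchi (h : IsLeviCivita G D) (X Y Z : VecField A) :
    curvatureOf D X Y Z + curvatureOf D Y Z X + curvatureOf D Z X Y = 0 := by
  have e (X Y Z : VecField A) : ⁅X, ⁅Y, Z⁆⁆ = D X (D Y Z) - D X (D Z Y) - D ⁅Y, Z⁆ X := by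
    rw [← h.torsion X ⁅Y, Z⁆, ← h.sub_right, h.torsion Y Z]
  have j := lie_jacobi X Y Z
  rw [e, e, e] at j
  rw [← j]
  simp only [curvatureOf]
  abel

/-- Metric compatibility, applied to [X, Y] acting on the function G(Z, W), both directly and as a
commutator. -/
theorem curvature_skew (h : IsLeviCivita G D) (X Y Z W : VecField A) :
    G (curvatureOf D X Y Z) W = -G Z (curvatureOf D X Y W) := by
  have e1 := congrArg X (h.metric Y Z W)
  have e2 := congrArg Y (h.metric X Z W)
  have e3 := h.metric ⁅X, Y⁆ Z W
  simp only [map_add, h.metric X, h.metric Y] at e1 e2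
  rw [Derivation.commutator_apply, h.metric Y, h.metric X, map_add, map_add, h.metric X,
    h.metric X, h.metric Y, h.metric Y] at e3
  simp only [curvatureOf, map_sub, LinearMap.sub_apply]
  linear_combination e3

theorem sum_frame_mul (hf : IsDualFrame G E F) (X Y : VecField A) :
    ∑ i, G X (F i) * G (E i) Y = G X Y := by
  conv_rhs => rw [← hf.left_expand X]
  simp

theorem expand_bilin (hf : IsDualFrame G E F) (B : VecField A →ₗ[A] VecField A →ₗ[A] A)
    (X Y : VecField A) : B X Y = ∑ j, ∑ k, G X (F j) * G Y (E k) * B (E j) (F k) := by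
  conv_lhs => rw [← hf.left_expand X, ← hf.right_expand Y]
  simp only [map_sum, map_smul, LinearMap.sum_apply, LinearMap.smul_apply, smul_eq_mul,
    Finset.mul_sum]
  rw [Finset.sum_comm]
  refine Finset.sum_congr rfl fun j _ => Finset.sum_congr rfl fun k _ => ?_
  ring

/-- The tensor ∑ Eᵢ ⊗ Fᵢ is the inverse of G and hence symmetric, although `B` need not be. -/
theorem trace_comm (h : IsLeviCivita G D) (hf : IsDualFrame G E F)
    (B : VecField A →ₗ[A] VecField A →ₗ[A] A) :
    ∑ i, B (F i) (E i) = ∑ i, B (E i) (F i) := by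
  have e (i : Fin m) := expand_bilin hf B (F i) (E i)
  simp only [e]
  rw [Finset.sum_comm]
  have e2 (j : Fin m) : B (E j) (F j) = ∑ k, G (F j) (E k) * B (E j) (F k) := by
    conv_lhs => rw [← hf.right_expand (F j)]
    simp
  refine Finset.sum_congr rfl fun j _ => ?_
  rw [e2, Finset.sum_comm]
  refine Finset.sum_congr rfl fun k _ => ?_
  rw [← Finset.sum_mul, ← sum_frame_mul hf (F j)]
  simp only [h.symm _ (F j)]

/-- The inverse metric ∑ Eᵢ ⊗ Fᵢ is parallel: differentiate ∑ G(X, Fᵢ) G(Eᵢ, Y) = G(X, Y). -/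
theorem trace_deriv_frame (h : IsLeviCivita G D) (hf : IsDualFrame G E F)
    (B : VecField A →ₗ[A] VecField A →ₗ[A] A) (Z : VecField A) :
    ∑ i, (B (D Z (E i)) (F i) + B (E i) (D Z (F i))) = 0 := by
  have e (i : Fin m) := (expand_bilin hf B (D Z (E i)) (F i)).symm
  have e' (i : Fin m) := (expand_bilin hf B (E i) (D Z (F i))).symm
  simp only [← e, ← e', ← Finset.sum_add_distrib]
  rw [Finset.sum_comm]
  refine Finset.sum_eq_zero fun j _ => ?_
  rw [Finset.sum_comm]
  refine Finset.sum_eq_zero fun k _ => ?_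
  simp only [← add_mul]
  rw [← Finset.sum_mul]
  have m1 := congrArg Z (sum_frame_mul hf (E k) (F j))
  simp only [map_sum, Derivation.leibniz, h.metric, smul_eq_mul] at m1
  have k1 := sum_frame_mul hf (E k) (D Z (F j))
  have k2 := sum_frame_mul hf (D Z (E k)) (F j)
  have : ∑ i, (G (D Z (E i)) (F j) * G (F i) (E k) + G (E i) (F j) * G (D Z (F i)) (E k)) = 0 := by
    rw [← k1, ← k2, ← Finset.sum_add_distrib, ← sub_eq_zero, ← Finset.sum_sub_distrib] at m1
    rw [← m1]
    refine Finset.sum_congr rfl fun i _ => ?_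
    rw [h.symm _ (E k), h.symm _ (E k)]
    ring
  rw [this, zero_mul]

/-- The trace commutes with covariant differentiation. -/
theorem deriv_trace (h : IsLeviCivita G D) (hf : IsDualFrame G E F)
    (B : VecField A →ₗ[A] VecField A →ₗ[A] A) (Z : VecField A) :
    Z (∑ i, B (E i) (F i)) =
      ∑ i, (Z (B (E i) (F i)) - B (D Z (E i)) (F i) - B (E i) (D Z (F i))) := by
  have e := trace_deriv_frame h hf B Z
  rw [map_sum, ← sub_zero (∑ i, Z _), ← e, ← Finset.sum_sub_distrib]
  exact Finset.sum_congr rfl fun i _ => by ring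

/-- By the Bianchi identity the antisymmetric part is, up to sign, the trace of X ↦ R(Y, Z)X.
Skewness of the curvature makes that trace equal to its own negative. -/
theorem ricci_comm (h : IsLeviCivita G D) (hf : IsDualFrame G E F) (Y Z : VecField A) :
    ricciOf G D E F Y Z = ricciOf G D E F Z Y := by
  let B : VecField A →ₗ[A] VecField A →ₗ[A] A :=
    { toFun X := G (curvatureOf D Y Z X)
      map_add' X X' := by rw [h.curvature_add_right, map_add]
      map_smul' a X := by rw [h.curvature_smul_right, map_smul, RingHom.id_apply] }
  have hB (X W) : B X W = G (curvatureOf D Y Z X) W := rfl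
  have t : ∑ i, B (E i) (F i) = -∑ i, B (E i) (F i) := by
    conv_lhs => rw [← trace_comm h hf]
    rw [← Finset.sum_neg_distrib]
    refine Finset.sum_congr rfl fun i _ => ?_
    rw [hB, hB, h.curvature_skew, h.symm]
  have t0 : ∑ i, B (E i) (F i) = 0 := by
    have : (2 : ℝ) • ∑ i, B (E i) (F i) = 0 := by
      rw [two_smul]
      nth_rw 1 [t]
      exact neg_add_cancel _
    simpa using this
  rw [← sub_eq_zero, ricciOf, ricciOf, ← Finset.sum_sub_distrib, ← neg_eq_zero, ← t0,
    ← Finset.sum_neg_distrib]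
  refine Finset.sum_congr rfl fun i _ => ?_
  have b := congrArg (fun X => G X (F i)) (h.curvature_bianchi (E i) Y Z)
  simp only [map_add, LinearMap.add_apply, map_zero, LinearMap.zero_apply,
    h.curvature_swap (E i) Z Y, map_neg, LinearMap.neg_apply] at b
  rw [hB]
  linear_combination -b

theorem ricci_add_right (h : IsLeviCivita G D) (Y Z Z' : VecField A) :
    ricciOf G D E F Y (Z + Z') = ricciOf G D E F Y Z + ricciOf G D E F Y Z' := by
  simp only [ricciOf, h.curvature_add_right, map_add, LinearMap.add_apply, Finset.sum_add_distrib]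

theorem ricci_smul_right (h : IsLeviCivita G D) (a : A) (Y Z : VecField A) :
    ricciOf G D E F Y (a • Z) = a * ricciOf G D E F Y Z := by
  simp only [ricciOf, h.curvature_smul_right, map_smul, LinearMap.smul_apply, Finset.mul_sum,
    smul_eq_mul]

theorem sndDeriv_smul (h : IsLeviCivita G D) (a : A) (X Y Z : VecField A) :
    sndDeriv D X Y (a • Z) = a • sndDeriv D X Y Z + X a • D Y Z + Y a • D X Z
      + (X (Y a) - D X Y a) • Z := by
  simp only [sndDeriv, h.smul_right, h.add_right]
  module

theorem roughLaplacian_add (h : IsLeviCivita G D) (Z Z' : VecField A) :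
    roughLaplacian D E F (Z + Z') = roughLaplacian D E F Z + roughLaplacian D E F Z' := by
  simp only [roughLaplacian, ← Finset.sum_add_distrib, sndDeriv, h.add_right]
  exact Finset.sum_congr rfl fun i _ => by abel

/-- Here `N` is the gradient of a, and the last coefficient is its divergence. The shape matches the
Leibniz rule of the Hodge Laplacian, so that the two can be compared. -/
theorem roughLaplacian_smul (h : IsLeviCivita G D) (hf : IsDualFrame G E F) {a : A}
    {N : VecField A} (hN : ∀ X, G N X = X a) (Z : VecField A) :
    roughLaplacian D E F (a • Z) = a • roughLaplacian D E F Z + (2 : A) • D N Z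
      + (∑ i, G (D (E i) N) (F i)) • Z := by
  have e1 : ∑ i, (E i) a • D (F i) Z = D N Z := by
    conv_rhs => rw [← hf.right_expand N]
    simp only [h.sum_left, h.smul_left, hN]
  have e2 : ∑ i, (F i) a • D (E i) Z = D N Z := by
    conv_rhs => rw [← hf.left_expand N]
    simp only [h.sum_left, h.smul_left, hN]
  have e3 (i : Fin m) : (E i) ((F i) a) - D (E i) (F i) a = G (D (E i) N) (F i) := by
    rw [← hN, ← hN, h.metric]
    ring
  simp only [roughLaplacian, h.sndDeriv_smul, Finset.sum_add_distrib, e1, e2, e3,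
    ← Finset.smul_sum, ← Finset.sum_smul]
  module

/-- Bochner's formula for the divergence of a gradient. -/
theorem deriv_div_grad (h : IsLeviCivita G D) (hf : IsDualFrame G E F) {a : A}
    {N : VecField A} (hN : ∀ X, G N X = X a) (Z : VecField A) :
    Z (∑ i, G (D (E i) N) (F i)) = G (roughLaplacian D E F N) Z - ricciOf G D E F Z N := by
  -- The Hessian of a is symmetric because the torsion vanishes; `hess2` is its covariant
  -- derivative.
  have hess (X Y : VecField A) : G (D X N) Y = G (D Y N) X := by
    have e1 := h.metric X N Y
    have e2 := h.metric Y N X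
    have e3 := congrArg (fun W : VecField A => W a) (h.torsion X Y)
    simp only [Derivation.sub_apply, Derivation.commutator_apply] at e3
    rw [hN, hN] at e1 e2
    linear_combination e2 - e1 - e3
  have hess2 (U X Y : VecField A) : G (sndDeriv D U X N) Y = G (sndDeriv D U Y N) X := by
    have e1 := h.metric U (D X N) Y
    have e2 := h.metric U (D Y N) X
    rw [hess Y X] at e2
    simp only [sndDeriv, map_sub, LinearMap.sub_apply]
    linear_combination e2 - e1 - hess X (D U Y) - hess (D U X) Y
  let B : VecField A →ₗ[A] VecField A →ₗ[A] A :=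
    { toFun X := G (D X N)
      map_add' X X' := by rw [h.add_left, map_add]
      map_smul' a X := by rw [h.smul_left, map_smul, RingHom.id_apply] }
  rw [show (∑ i, G (D (E i) N) (F i)) = ∑ i, B (E i) (F i) from rfl, h.deriv_trace hf B,
    roughLaplacian, ricciOf, map_sum, LinearMap.sum_apply, ← Finset.sum_sub_distrib]
  refine Finset.sum_congr rfl fun i _ => ?_
  -- Moving Z from the last slot to a differentiation slot and then past Eᵢ costs one curvature
  -- term, whose trace is Ricci.
  rw [hess2 (E i) (F i) Z, ← LinearMap.sub_apply, ← map_sub, h.curvature_eq, sub_sub_cancel]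
  change Z (G (D (E i) N) (F i)) - G (D (D Z (E i)) N) (F i) - G (D (E i) N) (D Z (F i)) = _
  rw [h.metric, sndDeriv, map_sub, LinearMap.sub_apply]
  ring

theorem sum_deriv_frame (h : IsLeviCivita G D) (hf : IsDualFrame G E F) (V Y Z : VecField A) :
    ∑ j, (G (D V (F j)) Y * G (E j) Z + G (F j) Y * G (D V (E j)) Z) = 0 := by
  have m1 := congrArg V (sum_frame_mul hf Y Z)
  simp only [map_sum, Derivation.leibniz, h.metric, smul_eq_mul, ← sum_frame_mul hf Y (D V Z),
    ← sum_frame_mul hf (D V Y) Z, ← Finset.sum_add_distrib] at m1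
  rw [← sub_eq_zero, ← Finset.sum_sub_distrib] at m1
  rw [← m1]
  refine Finset.sum_congr rfl fun i _ => ?_
  rw [h.symm _ Y, h.symm _ Y]
  ring

theorem sum_sndDeriv_frame (h : IsLeviCivita G D) (hf : IsDualFrame G E F)
    (U V Y Z : VecField A) :
    ∑ j, (G (sndDeriv D U V (F j)) Y * G (E j) Z + G (F j) Y * G (sndDeriv D U V (E j)) Z +
      G (D V (F j)) Y * G (D U (E j)) Z + G (D U (F j)) Y * G (D V (E j)) Z) = 0 := by
  have e := congrArg U (h.sum_deriv_frame hf V Y Z)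
  have e1 := h.sum_deriv_frame hf (D U V) Y Z
  have e2 := h.sum_deriv_frame hf V (D U Y) Z
  have e3 := h.sum_deriv_frame hf V Y (D U Z)
  simp only [map_zero, map_sum, map_add, Derivation.leibniz, h.metric, smul_eq_mul] at e
  -- Subtracting the first-order identities at ∇_U V, ∇_U Y and ∇_U Z leaves only derivatives of the
  -- frame.
  have e4 := congrArg₂ (· - ·) (congrArg₂ (· - ·) (congrArg₂ (· - ·) e e1) e2) e3
  simp only [sub_zero, ← Finset.sum_sub_distrib] at e4
  rw [← e4]
  refine Finset.sum_congr rfl fun j _ => ?_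
  simp only [sndDeriv, map_sub, LinearMap.sub_apply]
  ring

/-- The rough Laplacian annihilates the metric. -/
theorem sum_roughLaplacian_frame (h : IsLeviCivita G D) (hf : IsDualFrame G E F)
    (Y Z : VecField A) :
    ∑ j, (G (roughLaplacian D E F (F j)) Y * G (E j) Z
      + G (F j) Y * G (roughLaplacian D E F (E j)) Z
      + 2 * ∑ i, G (D (F i) (F j)) Y * G (D (E i) (E j)) Z) = 0 := by
  have e := Finset.sum_eq_zero (s := Finset.univ) fun i _ =>
    h.sum_sndDeriv_frame hf (E i) (F i) Y Z
  rw [Finset.sum_comm] at e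
  rw [← e]
  -- The two cross terms differ by exchanging Eᵢ and Fᵢ; symmetry of the trace merges them into the
  -- factor 2.
  have c (j : Fin m) : ∑ i, G (D (F i) (F j)) Y * G (D (E i) (E j)) Z =
      ∑ i, G (D (E i) (F j)) Y * G (D (F i) (E j)) Z :=
    trace_comm h hf (LinearMap.mk₂ A (fun U V => G (D U (F j)) Y * G (D V (E j)) Z)
      (fun U U' V => by simp [h.add_left, add_mul])
      (fun c U V => by simp [h.smul_left, mul_assoc])
      (fun U V V' => by simp [h.add_left, mul_add])
      (fun c U V => by simp [h.smul_left, mul_left_comm]))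
  refine Finset.sum_congr rfl fun j _ => ?_
  simp only [roughLaplacian, map_sum, LinearMap.sum_apply, Finset.sum_add_distrib,
    ← Finset.sum_mul, ← Finset.mul_sum, ← c j]
  ring

end IsLeviCivita

end LeviCivita

end DerivationForms

/-! ### The extension of Δ to 1-1-forms. -/

namespace DerivationForms

section Extension

variable {A : Type*} [CommRing A] [Algebra ℝ A] {δ : Forms A →ₗ[ℝ] Forms A}
  {hδ : IsSymmetricCodifferential δ} {m : ℕ} {α β : Fin m → Form A 1}

theorem hodgeLaplacian_add (ω η : Form A 1) :
    hodgeLaplacian δ (ω + η) = hodgeLaplacian δ ω + hodgeLaplacian δ η := by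
  rw [hodgeLaplacian, hodgeLaplacian, hodgeLaplacian, codiff₁_add, d₀_add, d₁_add, codiff₂_add]
  abel

theorem hodgeLaplacian_d₀ (a : A) : hodgeLaplacian δ (d₀ a) = d₀ (codiff₁ δ (d₀ a)) := by
  rw [hodgeLaplacian, d₁_d₀, codiff₂_zero, add_zero]

/-- Expanding d(δ(aω)) and δ(d(aω)) produces every term of 2∇_{da}ω except -(δda)ω, since d(da) = 0;
hence the last summand. -/
theorem IsInverseMetric.hodgeLaplacian_smul (hg : IsInverseMetric hδ (∑ i, α i ⊗ₜ[A] β i))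
    (a : A) (ω : Form A 1) :
    hodgeLaplacian δ (a • ω) = a • hodgeLaplacian δ ω + (2 : A) • nabla hδ (d₀ a) ω
      + codiff₁ δ (d₀ a) • ω := by
  have h2 (x : Form A 1) : (2 : A) • (1 / 2 : ℝ) • x = x := by
    rw [two_smul, ← add_smul]
    norm_num
  rw [hodgeLaplacian, hodgeLaplacian, codiff₁_smul hδ, d₁_smul, codiff₂_add, hg.codiff₂_smul,
    d₀_add, d₀_mul, nabla, h2, d₁_d₀, interior_zero, hg.pairing_comm (d₀ a)]
  module

theorem IsInverseMetric.sum_pairing_smul_nabla_left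
    (hg : IsInverseMetric hδ (∑ i, α i ⊗ₜ[A] β i)) (ω η : Form A 1) :
    ∑ i, pairing hδ (α i) ω • nabla hδ (β i) η = nabla hδ ω η := by
  have e := map_sum (AddMonoidHom.mk' (fun ω => nabla hδ ω η) fun ω ω' => nabla_add_left ω ω' η)
    (fun i => pairing hδ ω (α i) • β i) Finset.univ
  rw [hg.left_expand] at e
  simpa [hg.nabla_smul_left, hg.pairing_comm ω] using e.symm

theorem IsInverseMetric.sum_pairing_smul_nabla_right
    (hg : IsInverseMetric hδ (∑ i, α i ⊗ₜ[A] β i)) (ω η : Form A 1) :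
    ∑ i, pairing hδ (β i) ω • nabla hδ (α i) η = nabla hδ ω η := by
  have e := map_sum (AddMonoidHom.mk' (fun ω => nabla hδ ω η) fun ω ω' => nabla_add_left ω ω' η)
    (fun i => pairing hδ (β i) ω • α i) Finset.univ
  rw [hg.right_expand] at e
  simpa [hg.nabla_smul_left] using e.symm

/-- The second-order Leibniz expression, as an additive map in both arguments. -/
noncomputable def leibnizLaplacian (hδ : IsSymmetricCodifferential δ) (α β : Fin m → Form A 1) :
    Form A 1 →+ Form A 1 →+ OneOneForm A :=
  AddMonoidHom.mk'
    (fun ω => AddMonoidHom.mk'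
      (fun η => hodgeLaplacian δ ω ⊗ₜ[A] η + ω ⊗ₜ[A] hodgeLaplacian δ η
        + (2 : ℝ) • ∑ i, nabla hδ (α i) ω ⊗ₜ[A] nabla hδ (β i) η)
      (fun η η' => by
        simp only [hodgeLaplacian_add, nabla_add_right, TensorProduct.tmul_add,
          Finset.sum_add_distrib, smul_add]
        abel))
    (fun ω ω' => by
      ext η
      simp only [AddMonoidHom.add_apply, AddMonoidHom.mk'_apply, hodgeLaplacian_add,
        nabla_add_right, TensorProduct.add_tmul, Finset.sum_add_distrib, smul_add]
      abel)

theorem leibnizLaplacian_apply (ω η : Form A 1) : leibnizLaplacian hδ α β ω η =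
    hodgeLaplacian δ ω ⊗ₜ[A] η + ω ⊗ₜ[A] hodgeLaplacian δ η
      + (2 : ℝ) • ∑ i, nabla hδ (α i) ω ⊗ₜ[A] nabla hδ (β i) η := rfl

/-- Both sides exceed a times the expression at (ω, η) by 2∇_{da}ω ⊗ η + 2ω ⊗ ∇_{da}η + (δda)ω ⊗ η:
one gradient term comes from Δ, the other from the cross term. So the map is balanced, though not
`A`-linear. -/
theorem IsInverseMetric.leibnizLaplacian_smul (hg : IsInverseMetric hδ (∑ i, α i ⊗ₜ[A] β i))
    (a : A) (ω η : Form A 1) :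
    leibnizLaplacian hδ α β (a • ω) η = leibnizLaplacian hδ α β ω (a • η) := by
  have e1 : ∑ i, ω ⊗ₜ[A] (pairing hδ (α i) (d₀ a) • nabla hδ (β i) η) =
      ω ⊗ₜ[A] nabla hδ (d₀ a) η := by
    rw [← hg.sum_pairing_smul_nabla_left (d₀ a) η, TensorProduct.tmul_sum]
  have e2 : ∑ i, nabla hδ (α i) ω ⊗ₜ[A] (pairing hδ (β i) (d₀ a) • η) =
      nabla hδ (d₀ a) ω ⊗ₜ[A] η := by
    rw [← hg.sum_pairing_smul_nabla_right (d₀ a) ω, TensorProduct.sum_tmul]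
    simp only [TensorProduct.smul_tmul]
  simp only [leibnizLaplacian_apply, hg.hodgeLaplacian_smul, nabla_smul_right,
    TensorProduct.add_tmul, TensorProduct.tmul_add, Finset.sum_add_distrib, e1, e2, smul_add,
    two_smul, TensorProduct.smul_tmul (R := A)]
  abel

theorem d₀_algebraMap (r : ℝ) : d₀ (algebraMap ℝ A r) = 0 :=
  form_one_ext fun X => by simp

theorem nabla_zero_left (η : Form A 1) : nabla hδ 0 η = 0 := by
  have h := nabla_add_left (hδ := hδ) 0 0 η
  simpa using h

/-- Constants have zero differential, so all correction terms vanish. -/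
theorem IsInverseMetric.leibnizLaplacian_algebraMap_smul
    (hg : IsInverseMetric hδ (∑ i, α i ⊗ₜ[A] β i)) (r : ℝ) (ω η : Form A 1) :
    leibnizLaplacian hδ α β (r • ω) η = r • leibnizLaplacian hδ α β ω η := by
  have e : nabla hδ (d₀ (algebraMap ℝ A r)) ω = 0 := by rw [d₀_algebraMap, nabla_zero_left]
  have s (x : Form A 1) : algebraMap ℝ A r • x = r • x := algebraMap_smul A r x
  have e1 : hodgeLaplacian δ (r • ω) = r • hodgeLaplacian δ ω := by
    rw [← s, ← s, hg.hodgeLaplacian_smul, e, d₀_algebraMap, codiff₁_zero, smul_zero, zero_smul,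
      add_zero, add_zero]
  have e2 (i : Fin m) : nabla hδ (α i) (r • ω) = r • nabla hδ (α i) ω := by
    rw [← s, ← s, nabla_smul_right, d₀_algebraMap, map_zero, zero_smul, add_zero]
  simp only [leibnizLaplacian_apply, e1, e2, smul_add, ← TensorProduct.smul_tmul', Finset.smul_sum,
    smul_comm r (2 : ℝ)]

/-- The Hodge Laplacian on `1`-`1`-forms. -/
noncomputable def IsInverseMetric.hodgeExtension (hg : IsInverseMetric hδ (∑ i, α i ⊗ₜ[A] β i)) :
    OneOneForm A →ₗ[ℝ] OneOneForm A where
  toFun := TensorProduct.liftAddHom (leibnizLaplacian hδ α β) fun a ω η =>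
    hg.leibnizLaplacian_smul a ω η
  map_add' := map_add _
  map_smul' r t := by
    induction t using TensorProduct.induction_on with
    | zero => simp
    | add x y hx hy => rw [smul_add, map_add, hx, hy, map_add, smul_add]
    | tmul ω η =>
      rw [TensorProduct.smul_tmul', TensorProduct.liftAddHom_tmul, TensorProduct.liftAddHom_tmul,
        hg.leibnizLaplacian_algebraMap_smul, RingHom.id_apply]

/-- Since ∇ is `A`-linear in its direction, the cross term is the image of g under ∇ω ⊗ ∇η and does
not see the decomposition of g. -/
theorem IsInverseMetric.sum_nabla_tmul_nabla (hg : IsInverseMetric hδ (∑ i, α i ⊗ₜ[A] β i))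
    (ω η : Form A 1) {k : ℕ} (α' β' : Fin k → Form A 1)
    (h : ∑ i, α i ⊗ₜ[A] β i = ∑ i, α' i ⊗ₜ[A] β' i) :
    ∑ i, nabla hδ (α i) ω ⊗ₜ[A] nabla hδ (β i) η =
      ∑ i, nabla hδ (α' i) ω ⊗ₜ[A] nabla hδ (β' i) η := by
  let N (ω : Form A 1) : Form A 1 →ₗ[A] Form A 1 :=
    { toFun ζ := nabla hδ ζ ω
      map_add' ζ ζ' := nabla_add_left ζ ζ' ω
      map_smul' a ζ := hg.nabla_smul_left a ζ ω }
  have := congrArg (TensorProduct.map (N ω) (N η)) h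
  simp only [map_sum, TensorProduct.map_tmul] at this
  exact this

theorem IsInverseMetric.existsUnique_hodgeExtension
    (hg : IsInverseMetric hδ (∑ i, α i ⊗ₜ[A] β i)) :
    ∃! L, IsHodgeExtension hδ (∑ i, α i ⊗ₜ[A] β i) L := by
  refine ⟨hg.hodgeExtension, fun k α' β' h ω η => ?_, fun L hL => ?_⟩
  · rw [← hg.sum_nabla_tmul_nabla ω η α' β' h]
    rfl
  · ext t
    induction t using TensorProduct.induction_on with
    | zero => simp
    | add x y hx hy => rw [map_add, map_add, hx, hy]
    | tmul ω η => exact hL m α β rfl ω η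

end Extension

end DerivationForms

/-! ### From forms to vector fields; the Laplacian of the metric. -/

namespace DerivationForms

section Glue

variable {A : Type*} [CommRing A] [Algebra ℝ A] {δ : Forms A →ₗ[ℝ] Forms A}
  {hδ : IsSymmetricCodifferential δ} {m : ℕ} {α β : Fin m → Form A 1}

@[simp]
theorem evalTensor_tmul (X Y : VecField A) (ω η : Form A 1) :
    evalTensor X Y (ω ⊗ₜ[A] η) = ω ![X] * η ![Y] := rfl

/-- The metric on vector fields given by a `1`-`1`-form. -/
noncomputable def metricVec (g : OneOneForm A) : VecField A →ₗ[A] VecField A →ₗ[A] A :=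
  LinearMap.mk₂ A (fun X Y => evalTensor X Y g)
    (fun X X' Y => by
      induction g using TensorProduct.induction_on with
      | zero => simp
      | tmul ω η => simp [form_add, add_mul]
      | add g g' h h' => simp only [map_add, h, h']; ring)
    (fun c X Y => by
      induction g using TensorProduct.induction_on with
      | zero => simp
      | tmul ω η => simp [form_smul, mul_assoc]
      | add g g' h h' => simp only [map_add, h, h', smul_add])
    (fun X Y Y' => by
      induction g using TensorProduct.induction_on with
      | zero => simp
      | tmul ω η => simp [form_add, mul_add]
      | add g g' h h' => simp only [map_add, h, h']; ring)
    (fun c X Y => by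
      induction g using TensorProduct.induction_on with
      | zero => simp
      | tmul ω η => simp [form_smul, mul_left_comm]
      | add g g' h h' => simp only [map_add, h, h', smul_add])

theorem flat_sum (X : VecField A) :
    flat (∑ i, α i ⊗ₜ[A] β i) X = ∑ i, α i ![X] • β i := by
  simp [flat, evalVec_apply]

theorem metricVec_sum (X Y : VecField A) :
    metricVec (∑ i, α i ⊗ₜ[A] β i) X Y = ∑ i, α i ![X] * β i ![Y] := by
  simp [metricVec]

theorem flat_apply (X Y : VecField A) :
    flat (∑ i, α i ⊗ₜ[A] β i) X ![Y] = metricVec (∑ i, α i ⊗ₜ[A] β i) X Y := by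
  simp [flat_sum, metricVec_sum, form_sum_apply]

theorem IsInverseMetric.metricVec_sharp (hg : IsInverseMetric hδ (∑ i, α i ⊗ₜ[A] β i))
    (ω : Form A 1) (Y : VecField A) :
    metricVec (∑ i, α i ⊗ₜ[A] β i) (sharp hδ ω) Y = ω ![Y] := by
  conv_rhs => rw [← hg.left_expand ω]
  simp [metricVec_sum, form_sum_apply, pairing_apply]

theorem IsInverseMetric.flat_sharp (hg : IsInverseMetric hδ (∑ i, α i ⊗ₜ[A] β i))
    (ω : Form A 1) : flat (∑ i, α i ⊗ₜ[A] β i) (sharp hδ ω) = ω :=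
  form_one_ext fun Y => by rw [flat_apply, hg.metricVec_sharp]

theorem IsInverseMetric.sharp_flat (hg : IsInverseMetric hδ (∑ i, α i ⊗ₜ[A] β i))
    (X : VecField A) : sharp hδ (flat (∑ i, α i ⊗ₜ[A] β i) X) = X := by
  conv_rhs => rw [← hg.vec_expand X]
  simp [flat_sum]

theorem IsInverseMetric.sharp_surjective (hg : IsInverseMetric hδ (∑ i, α i ⊗ₜ[A] β i)) :
    Function.Surjective (sharp hδ) := fun X => ⟨_, hg.sharp_flat X⟩

theorem IsInverseMetric.nablaVec_sharp (hg : IsInverseMetric hδ (∑ i, α i ⊗ₜ[A] β i))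
    (ω η : Form A 1) : nablaVec hδ (∑ i, α i ⊗ₜ[A] β i) (sharp hδ ω) (sharp hδ η) =
      sharp hδ (nabla hδ ω η) := by
  rw [nablaVec, hg.flat_sharp, hg.flat_sharp]

theorem IsInverseMetric.isLeviCivita (hg : IsInverseMetric hδ (∑ i, α i ⊗ₜ[A] β i)) :
    IsLeviCivita (metricVec (∑ i, α i ⊗ₜ[A] β i)) (nablaVec hδ (∑ i, α i ⊗ₜ[A] β i)) where
  symm X Y := by
    obtain ⟨ω, rfl⟩ := hg.sharp_surjective X
    obtain ⟨η, rfl⟩ := hg.sharp_surjective Y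
    rw [hg.metricVec_sharp, hg.metricVec_sharp]
    exact hg.pairing_comm η ω
  add_left X Y Z := by
    obtain ⟨ω, rfl⟩ := hg.sharp_surjective X
    obtain ⟨η, rfl⟩ := hg.sharp_surjective Y
    obtain ⟨ζ, rfl⟩ := hg.sharp_surjective Z
    rw [← map_add, hg.nablaVec_sharp, hg.nablaVec_sharp, hg.nablaVec_sharp, nabla_add_left, map_add]
  smul_left a X Z := by
    obtain ⟨ω, rfl⟩ := hg.sharp_surjective X
    obtain ⟨ζ, rfl⟩ := hg.sharp_surjective Z
    rw [← map_smul, hg.nablaVec_sharp, hg.nablaVec_sharp, hg.nabla_smul_left, map_smul]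
  add_right X Y Z := by
    obtain ⟨ω, rfl⟩ := hg.sharp_surjective X
    obtain ⟨η, rfl⟩ := hg.sharp_surjective Y
    obtain ⟨ζ, rfl⟩ := hg.sharp_surjective Z
    rw [← map_add, hg.nablaVec_sharp, hg.nablaVec_sharp, hg.nablaVec_sharp, nabla_add_right,
      map_add]
  smul_right a X Z := by
    obtain ⟨ω, rfl⟩ := hg.sharp_surjective X
    obtain ⟨ζ, rfl⟩ := hg.sharp_surjective Z
    rw [← map_smul, hg.nablaVec_sharp, hg.nablaVec_sharp, nabla_smul_right, map_add, map_smul,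
      map_smul, sharp_apply]
  torsion X Y := by
    obtain ⟨ω, rfl⟩ := hg.sharp_surjective X
    obtain ⟨η, rfl⟩ := hg.sharp_surjective Y
    rw [hg.nablaVec_sharp, hg.nablaVec_sharp, hg.sharp_nabla_sub]
  metric X Y Z := by
    obtain ⟨ω, rfl⟩ := hg.sharp_surjective X
    obtain ⟨η, rfl⟩ := hg.sharp_surjective Y
    obtain ⟨ζ, rfl⟩ := hg.sharp_surjective Z
    -- Adding the Koszul formula to its copy with η and ζ exchanged cancels everything but 2ω^*(η,
    -- ζ).
    have e1 := hg.two_smul_pairing_nabla ω η ζ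
    have e2 := hg.two_smul_pairing_nabla ω ζ η
    have e3 : ω ![⁅sharp hδ ζ, sharp hδ η⁆] = -ω ![⁅sharp hδ η, sharp hδ ζ⁆] := by
      rw [eq_neg_iff_add_eq_zero, ← form_add, ← lie_skew, neg_add_cancel, form_zero_vec]
    simp only [hg.nablaVec_sharp, hg.metricVec_sharp, ← pairing_apply, hg.pairing_comm ζ η]
    rw [hg.pairing_comm ζ (nabla hδ ω η), ← sub_eq_zero]
    rw [hg.pairing_comm ζ η, e3] at e2
    refine (smul_eq_zero_iff_right (two_ne_zero (α := ℝ))).1 ?_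
    rw [smul_sub, smul_add, e1, e2, hg.pairing_comm η ζ, two_smul]
    ring

theorem IsInverseMetric.isDualFrame (hg : IsInverseMetric hδ (∑ i, α i ⊗ₜ[A] β i)) :
    IsDualFrame (metricVec (∑ i, α i ⊗ₜ[A] β i)) (fun i => sharp hδ (β i))
      (fun i => sharp hδ (α i)) where
  left_expand X := by
    conv_rhs => rw [← hg.vec_expand X]
    simp only [hg.isLeviCivita.symm X, hg.metricVec_sharp]
  right_expand X := by
    obtain ⟨ω, rfl⟩ := hg.sharp_surjective X
    conv_rhs => rw [← hg.right_expand ω]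
    simp only [map_sum, map_smul, hg.metricVec_sharp, ← pairing_apply]

theorem IsInverseMetric.ricci_eq (hg : IsInverseMetric hδ (∑ i, α i ⊗ₜ[A] β i))
    (Y Z : VecField A) : ricci hδ α β Y Z =
      ricciOf (metricVec (∑ i, α i ⊗ₜ[A] β i)) (nablaVec hδ (∑ i, α i ⊗ₜ[A] β i))
        (fun i => sharp hδ (β i)) (fun i => sharp hδ (α i)) Y Z := by
  refine Finset.sum_congr rfl fun i _ => ?_
  rw [hg.isLeviCivita.symm, hg.metricVec_sharp]
  rfl

/-- The Weitzenböck formula on `1`-forms. -/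
theorem IsInverseMetric.hodgeLaplacian_apply (hg : IsInverseMetric hδ (∑ i, α i ⊗ₜ[A] β i))
    (hdiv : IsDivergence hδ (∑ i, α i ⊗ₜ[A] β i)) (ω : Form A 1) (Z : VecField A) :
    hodgeLaplacian δ ω ![Z] = metricVec (∑ i, α i ⊗ₜ[A] β i)
      (roughLaplacian (nablaVec hδ (∑ i, α i ⊗ₜ[A] β i)) (fun i => sharp hδ (β i))
        (fun i => sharp hδ (α i)) (sharp hδ ω)) Z - ricci hδ α β Z (sharp hδ ω) := by
  have h := hg.isLeviCivita
  have hf := hg.isDualFrame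
  have hN (a : A) (X : VecField A) :
      metricVec (∑ i, α i ⊗ₜ[A] β i) (sharp hδ (d₀ a)) X = X a := hg.metricVec_sharp (d₀ a) X
  -- The divergence hypothesis enters here only: it identifies δda with the divergence of the
  -- gradient of a.
  have hd (a : A) : ∑ i, metricVec (∑ i, α i ⊗ₜ[A] β i)
      (nablaVec hδ (∑ i, α i ⊗ₜ[A] β i) (sharp hδ (β i)) (sharp hδ (d₀ a))) (sharp hδ (α i)) =
      codiff₁ δ (d₀ a) := by
    rw [hdiv m α β rfl]
    simp only [hg.nablaVec_sharp, hg.metricVec_sharp, pairing_apply]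
  -- The defect of the formula is `A`-linear, because both Laplacians obey the same Leibniz rule and
  -- Ricci is tensorial.
  let φ : Form A 1 →ₗ[A] A :=
    { toFun ω := hodgeLaplacian δ ω ![Z] - metricVec (∑ i, α i ⊗ₜ[A] β i)
        (roughLaplacian (nablaVec hδ (∑ i, α i ⊗ₜ[A] β i)) (fun i => sharp hδ (β i))
          (fun i => sharp hδ (α i)) (sharp hδ ω)) Z + ricci hδ α β Z (sharp hδ ω)
      map_add' ω η := by
        simp only [hodgeLaplacian_add, AlternatingMap.add_apply, map_add, h.roughLaplacian_add,
          LinearMap.add_apply, hg.ricci_eq, h.ricci_add_right]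
        ring
      map_smul' a ω := by
        rw [map_smul, h.roughLaplacian_smul hf (hN a), hd]
        simp only [hg.hodgeLaplacian_smul, AlternatingMap.add_apply, AlternatingMap.smul_apply,
          map_add, map_smul, LinearMap.add_apply,
          LinearMap.smul_apply, hg.ricci_eq, h.ricci_smul_right, smul_eq_mul,
          hg.nablaVec_sharp, hg.metricVec_sharp, RingHom.id_apply]
        ring }
  have hφ : φ = 0 := hg.functional_eq_zero φ fun a => by
    change hodgeLaplacian δ (d₀ a) ![Z] - _ + _ = 0
    rw [hodgeLaplacian_d₀, d₀_apply, ← hd, h.deriv_div_grad hf (hN a), hg.ricci_eq]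
    ring
  have e : hodgeLaplacian δ ω ![Z] - _ + _ = (0 : A) := LinearMap.congr_fun hφ ω
  linear_combination e

theorem IsInverseMetric.evalTensor_hodgeExtension
    (hg : IsInverseMetric hδ (∑ i, α i ⊗ₜ[A] β i))
    (hdiv : IsDivergence hδ (∑ i, α i ⊗ₜ[A] β i)) {L : OneOneForm A →ₗ[ℝ] OneOneForm A}
    (hL : IsHodgeExtension hδ (∑ i, α i ⊗ₜ[A] β i) L) (Y Z : VecField A) :
    evalTensor Y Z (L (∑ i, α i ⊗ₜ[A] β i)) = -2 * ricci hδ α β Y Z := by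
  have h := hg.isLeviCivita
  have hf := hg.isDualFrame
  have e := h.sum_roughLaplacian_frame hf Y Z
  let ρ (Y : VecField A) : VecField A →ₗ[A] A :=
    { toFun := ricci hδ α β Y
      map_add' Z Z' := by simp only [hg.ricci_eq, h.ricci_add_right]
      map_smul' a Z := by
        simp only [hg.ricci_eq, h.ricci_smul_right, smul_eq_mul, RingHom.id_apply] }
  have r1 : ∑ j, ricci hδ α β Y (sharp hδ (α j)) * β j ![Z] = ricci hδ α β Y Z := by
    have e := congrArg (ρ Y) (hf.right_expand Z)
    simp only [map_sum, map_smul, smul_eq_mul, h.symm Z, hg.metricVec_sharp] at e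
    refine Eq.trans (Finset.sum_congr rfl fun j _ => ?_) e
    exact mul_comm _ _
  -- The first tensor slot yields Ricci with its arguments transposed; symmetry of Ricci restores
  -- their order.
  have r2 : ∑ j, α j ![Y] * ricci hδ α β Z (sharp hδ (β j)) = ricci hδ α β Y Z := by
    have e := congrArg (ρ Z) (hg.vec_expand Y)
    simp only [map_sum, map_smul, smul_eq_mul] at e
    rw [hg.ricci_eq Y, h.ricci_comm hf, ← hg.ricci_eq]
    exact e
  have t (x : OneOneForm A) : evalTensor Y Z ((2 : ℝ) • x) = 2 * evalTensor Y Z x := by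
    rw [two_smul, map_add, two_mul]
  simp only [hg.nablaVec_sharp, hg.metricVec_sharp] at e
  have l : evalTensor Y Z (L (∑ i, α i ⊗ₜ[A] β i)) =
      ∑ j, (hodgeLaplacian δ (α j) ![Y] * β j ![Z] + α j ![Y] * hodgeLaplacian δ (β j) ![Z] +
        2 * ∑ i, nabla hδ (α i) (α j) ![Y] * nabla hδ (β i) (β j) ![Z]) := by
    simp only [map_sum, hL m α β rfl, map_add, t, evalTensor_tmul]
  rw [l]
  simp only [hg.hodgeLaplacian_apply hdiv]
  have e2 : -2 * ricci hδ α β Y Z = 0 - ∑ j, ricci hδ α β Y (sharp hδ (α j)) * β j ![Z]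
      - ∑ j, α j ![Y] * ricci hδ α β Z (sharp hδ (β j)) := by
    rw [r1, r2]
    ring
  -- The zero in `e2` is replaced by the rough Laplacian of g, after which the sums agree term by
  -- term.
  rw [e2, ← e, ← Finset.sum_sub_distrib, ← Finset.sum_sub_distrib]
  refine Finset.sum_congr rfl fun j _ => ?_
  ring

theorem IsInverseMetric.contract_eq (hg : IsInverseMetric hδ (∑ i, α i ⊗ₜ[A] β i))
    (t : OneOneForm A) :
    contract hδ t = ∑ i, evalTensor (sharp hδ (β i)) (sharp hδ (α i)) t := by
  induction t using TensorProduct.induction_on with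
  | zero => simp
  | add x y hx hy => simp only [map_add, hx, hy, Finset.sum_add_distrib]
  | tmul ω η =>
    rw [contract, TensorProduct.lift.tmul]
    conv_lhs => rw [← hg.right_expand ω]
    simp [pairing_apply]

theorem IsInverseMetric.einstein_identities {g : OneOneForm A} (hg : IsInverseMetric hδ g)
    {L : OneOneForm A →ₗ[ℝ] OneOneForm A} (hL : IsHodgeExtension hδ g L)
    (hdiv : IsDivergence hδ g) (h : g = ∑ i, α i ⊗ₜ[A] β i) :
    (∀ Y Z, evalTensor Y Z ((-1 / 2 : ℝ) • L g) = ricci hδ α β Y Z) ∧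
    scalarCurvature hδ α β = (-1 / 2 : ℝ) • contract hδ (L g) ∧
    (∀ Y Z, einstein hδ α β Y Z =
      evalTensor Y Z ((-1 / 2 : ℝ) • (L g + scalarCurvature hδ α β • g))) := by
  subst h
  have two (x : A) : (-1 / 2 : ℝ) • (-2 * x) = x := by
    rw [neg_mul, two_mul, ← two_smul ℝ]
    module
  have s (r : ℝ) (Y Z : VecField A) (t : OneOneForm A) :
      evalTensor Y Z (r • t) = r • evalTensor Y Z t := by
    rw [LinearMap.map_smul_of_tower]
  refine ⟨fun Y Z => ?_, ?_, fun Y Z => ?_⟩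
  · rw [s, hg.evalTensor_hodgeExtension hdiv hL, two]
  · rw [hg.contract_eq]
    simp only [hg.evalTensor_hodgeExtension hdiv hL, ← Finset.mul_sum, two]
    refine Finset.sum_congr rfl fun i _ => ?_
    -- The contraction evaluates at (βᵢ^*, αᵢ^*) and the scalar curvature at (αᵢ^*, βᵢ^*).
    rw [hg.ricci_eq, hg.ricci_eq, hg.isLeviCivita.ricci_comm hg.isDualFrame]
  · rw [s, map_add, hg.evalTensor_hodgeExtension hdiv hL, map_smul, smul_add, two, einstein,
      smul_eq_mul]
    module

end Glue

end DerivationForms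

/-! ### The case of smooth functions on a manifold. -/

theorem mainTheorem6 (n : ℕ) (M : Type*) [TopologicalSpace M] [T2Space M]
    [SecondCountableTopology M] [ChartedSpace (EuclideanSpace ℝ (Fin n)) M]
    [IsManifold (𝓡 n) ((⊤ : ℕ∞) : WithTop ℕ∞) M]
    (δ : DerivationForms.Forms C^((⊤ : ℕ∞) : WithTop ℕ∞)⟮𝓡 n, M; ℝ⟯ →ₗ[ℝ]
      DerivationForms.Forms C^((⊤ : ℕ∞) : WithTop ℕ∞)⟮𝓡 n, M; ℝ⟯)
    (hδ : DerivationForms.IsSymmetricCodifferential δ)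
    (g : DerivationForms.OneOneForm C^((⊤ : ℕ∞) : WithTop ℕ∞)⟮𝓡 n, M; ℝ⟯)
    (hg : DerivationForms.IsInverseMetric hδ g) :
    (∃! L : DerivationForms.OneOneForm C^((⊤ : ℕ∞) : WithTop ℕ∞)⟮𝓡 n, M; ℝ⟯ →ₗ[ℝ]
        DerivationForms.OneOneForm C^((⊤ : ℕ∞) : WithTop ℕ∞)⟮𝓡 n, M; ℝ⟯,
      DerivationForms.IsHodgeExtension hδ g L) ∧
    ∀ L : DerivationForms.OneOneForm C^((⊤ : ℕ∞) : WithTop ℕ∞)⟮𝓡 n, M; ℝ⟯ →ₗ[ℝ]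
        DerivationForms.OneOneForm C^((⊤ : ℕ∞) : WithTop ℕ∞)⟮𝓡 n, M; ℝ⟯,
      DerivationForms.IsHodgeExtension hδ g L → DerivationForms.IsDivergence hδ g →
      ∀ (m : ℕ) (α β : Fin m → DerivationForms.Form C^((⊤ : ℕ∞) : WithTop ℕ∞)⟮𝓡 n, M; ℝ⟯ 1),
        g = ∑ i, α i ⊗ₜ β i →
        (∀ Y Z, DerivationForms.evalTensor Y Z ((-1 / 2 : ℝ) • L g) =
          DerivationForms.ricci hδ α β Y Z) ∧
        DerivationForms.scalarCurvature hδ α β =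
          (-1 / 2 : ℝ) • DerivationForms.contract hδ (L g) ∧
        (∀ Y Z, DerivationForms.einstein hδ α β Y Z =
          DerivationForms.evalTensor Y Z
            ((-1 / 2 : ℝ) • (L g + DerivationForms.scalarCurvature hδ α β • g))) := by
  -- Any finite decomposition of g serves as the dual frame for (1); the identities in (2) are then
  -- proved for each decomposition separately.
  obtain ⟨m, α, β, rfl⟩ : ∃ (m : ℕ) (α β : Fin m → DerivationForms.Form
      C^((⊤ : ℕ∞) : WithTop ℕ∞)⟮𝓡 n, M; ℝ⟯ 1), g = ∑ i, α i ⊗ₜ β i := by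
    obtain ⟨S, rfl⟩ := TensorProduct.exists_finset g
    refine ⟨S.card, fun i => (S.equivFin.symm i).1.1, fun i => (S.equivFin.symm i).1.2, ?_⟩
    rw [← Finset.sum_coe_sort S, ← S.equivFin.symm.sum_comp]
  exact ⟨hg.existsUnique_hodgeExtension,
    fun L hL hdiv k α' β' h => hg.einstein_identities hL hdiv h⟩
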